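/- Let $\mathcal A\subseteq B(\mathcal H)$ be a von Neumann algebra and let $\tau:\mathcal A\to\mathcal A$ be a normal unital completely positive map. A minimal dilation of $\tau$ is a triple $(\mathcal K,\mathcal B,\theta)$, where $\mathcal K$ is a Hilbert space containing $\mathcal H$ as a closed subspace, $\mathcal B\subseteq B(\mathcal K)$ is a von Neumann algebra, and $\theta:\mathcal B\to\mathcal B$ is a normal unital $*$-endomorphism, such that, with $p$ the orthogonal projection of $\mathcal K$ onto $\mathcal H$ and $x\in B(\mathcal H)$ identified with $pxp\in B(\mathcal K)$: $\mathcal A\subseteq\mathcal B$ and $\mathcal A=p\mathcal Bp$; $\tau^n(x)=p\theta^n(x)p$ for all $x\in\mathcal A$, $n\ge 0$; the vectors $\theta^n(x_n)\theta^{n-1}(x_{n-1})\cdots\theta(x_1)h$ with $n\ge 0$, $x_i\in\mathcal A$, $h\in\mathcal H$ span a dense subspace of $\mathcal K$; and $\mathcal B$ is the von Neumann algebra generated by $\{\theta^n(x):n\ge 0,\ x\in\mathcal A\}$. For $\sigma=\tau$ or $\sigma=\theta$ let $\mathcal P(\sigma)$ be the norm closure of the linear span of the eigenvectors of $\sigma$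 whose eigenvalues lie on the unit circle $\mathbb T$. Then $\tau$ has a minimal dilation, and for every minimal dilation $(\mathcal K,\mathcal B,\theta)$ of $\tau$ the compression $T(z)=pzp$ maps $\mathcal P(\theta)$ bijectively onto $\mathcal P(\tau)$, so that $x\circ y:=T(T^{-1}(x)T^{-1}(y))$ is defined for $x,y\in\mathcal P(\tau)$. If $x,y\in\mathcal A$ satisfy $\tau(x)=\lambda x$ and $\tau(y)=\mu y$ with $\lambda,\mu\in\mathbb T$, then $$x\circ y=\operatorname*{s-lim}_{n\to\infty}(\lambda\mu)^{-n}\tau^n(xy),$$ the limit existing in the strong operator topology. If moreover there is a faithful state $\phi$ on $\mathcal A$ with $\phi\circ\tau=\phi$, then $x\circ y=xy$ for all such $x,y$. -/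

import Mathlib

open Filter Topology
open scoped CStarAlgebra ComplexOrder

universe u

noncomputable section

namespace VonNeumannAlgebra

variable {H : Type u} [NormedAddCommGroup H] [InnerProductSpace ℂ H] [CompleteSpace H]

/-! ### A von Neumann algebra, with the operator norm and the operator order, is a C⋆-algebra -/

instance instSMulMemClass : SMulMemClass (VonNeumannAlgebra H) ℂ (H →L[ℂ] H) where
  smul_mem {A} c _ hx := A.toStarSubalgebra.smul_mem hx c

instance instIsClosed (A : VonNeumannAlgebra H) : IsClosed (A : Set (H →L[ℂ] H)) := by
  rw [← A.centralizer_centralizer]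
  exact Set.isClosed_centralizer _

instance instCStarAlgebra (A : VonNeumannAlgebra H) : CStarAlgebra A :=
  StarSubalgebra.cstarAlgebra A

/-- The order on `A` is the restriction of the operator order of `B(H)`; it is the order given by
the positive cone `{s⋆s : s ∈ A}`. -/
instance instStarOrderedRing (A : VonNeumannAlgebra H) : StarOrderedRing A := by
  refine StarOrderedRing.of_nonneg_iff' (fun {x y} hxy z => ?_) (fun x => ⟨fun hx => ?_, ?_⟩)
  · exact add_le_add_right (show (x : H →L[ℂ] H) ≤ y from hxy) (z : H →L[ℂ] H)
  · have hx' : (0 : H →L[ℂ] H) ≤ x := hx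
    have hs : CFC.sqrt (x : H →L[ℂ] H) ∈ A := by
      rw [CFC.sqrt_eq_real_sqrt (x : H →L[ℂ] H) hx']
      exact cfcₙ_mem (𝕜' := ℂ) _ x.2
    refine ⟨⟨_, hs⟩, Subtype.ext ?_⟩
    show (x : H →L[ℂ] H) = star (CFC.sqrt (x : H →L[ℂ] H)) * CFC.sqrt (x : H →L[ℂ] H)
    rw [(CFC.sqrt_nonneg (x : H →L[ℂ] H)).isSelfAdjoint.star_eq, CFC.sqrt_mul_sqrt_self _ hx']
  · rintro ⟨s, rfl⟩
    exact star_mul_self_nonneg (s : H →L[ℂ] H)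

end VonNeumannAlgebra

/-- The norm closure of the linear span of the eigenvectors of `f` whose eigenvalues lie on the
unit circle. -/
def peripheralSpace {M : Type*} [NormedAddCommGroup M] [NormedSpace ℂ M] (f : M → M) :
    Submodule ℂ M :=
  (Submodule.span ℂ {x : M | ∃ c : ℂ, ‖c‖ = 1 ∧ f x = c • x}).topologicalClosure

/-- A dilation of the map `τ : A → A`, where `A ⊆ B(H)`, to a normal unital `*`-endomorphism `θ` of
a von Neumann algebra `B ⊆ B(K)`. The inclusion of `H` in `K` as a closed subspace is the isometry
`ι`, so that `ι ι⋆` is the projection `p` of `K` onto `H`, an operator `x` of `H` is identified with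
the operator `ι x ι⋆ = p x p` of `K`, and the compression `p z p` of an operator `z` of `K`,
regarded as an operator of `H`, is `ι⋆ z ι`. -/
structure VNDilation {H : Type u} [NormedAddCommGroup H] [InnerProductSpace ℂ H] [CompleteSpace H]
    {A : VonNeumannAlgebra H} (τ : A →CP A) where
  K : Type u
  [normedAddCommGroup : NormedAddCommGroup K]
  [innerProductSpace : InnerProductSpace ℂ K]
  [completeSpace : CompleteSpace K]
  ι : H →ₗᵢ[ℂ] K
  B : VonNeumannAlgebra K
  /-- `A ⊆ B`; together with the next field, this says that `A = p B p`. -/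
  embed_mem : ∀ a ∈ A, ι.toContinuousLinearMap ∘L a ∘L ι.toContinuousLinearMap.adjoint ∈ B
  compress_mem : ∀ b ∈ B, ι.toContinuousLinearMap.adjoint ∘L b ∘L ι.toContinuousLinearMap ∈ A
  /-- `θ` is a unital `*`-endomorphism of `B`. -/
  θ : B →⋆ₐ[ℂ] B
  /-- `θ` is normal: it preserves suprema of bounded increasing nets. -/
  normal : ScottContinuous θ
  /-- `τⁿ(a) = p θⁿ(a) p`. -/
  dilates : ∀ (n : ℕ) (a : A), ((τ^[n] a : A) : H →L[ℂ] H) =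
    ι.toContinuousLinearMap.adjoint ∘L ((θ^[n] ⟨_, embed_mem a a.2⟩ : B) : K →L[ℂ] K) ∘L
      ι.toContinuousLinearMap

namespace VNDilation

attribute [instance] normedAddCommGroup innerProductSpace completeSpace

variable {H : Type u} [NormedAddCommGroup H] [InnerProductSpace ℂ H] [CompleteSpace H]
  {A : VonNeumannAlgebra H} {τ : A →CP A} (D : VNDilation τ)

/-- The inclusion of `A` in `B`. -/
def embed (a : A) : D.B := ⟨_, D.embed_mem a a.2⟩

/-- The compression map `T : B → A`, `z ↦ p z p`. -/
def compress (b : D.B) : A := ⟨_, D.compress_mem b b.2⟩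

/-- The vector `θⁿ(xₙ) θⁿ⁻¹(xₙ₋₁) ⋯ θ(x₁) h`, for the list `[xₙ, xₙ₋₁, …, x₁]`. -/
def word : List A → H → D.K
  | [], h => D.ι h
  | x :: l, h => ((D.θ^[l.length + 1] (D.embed x) : D.B) : D.K →L[ℂ] D.K) (word l h)

/-- The dilation is minimal: the vectors `θⁿ(xₙ) ⋯ θ(x₁) h` span a dense subspace of `K`, and `B` is
the von Neumann algebra generated by the operators `θⁿ(x)` with `n ≥ 0` and `x ∈ A`. -/
structure IsMinimal : Prop where
  space : (Submodule.span ℂ {v : D.K | ∃ (l : List A) (h : H), v = D.word l h}).topologicalClosure = ⊤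
  algebra : ∀ C : VonNeumannAlgebra D.K,
    (∀ (n : ℕ) (x : A), ((D.θ^[n] (D.embed x) : D.B) : D.K →L[ℂ] D.K) ∈ C) → D.B ≤ C

/-- The product `x ∘ y = T (T⁻¹ x * T⁻¹ y)` on the peripheral space of `τ`, where `T⁻¹` is the
inverse of the compression map `T` from the peripheral space of `θ` to that of `τ`. -/
def peripheralMul (x y : A) : A :=
  D.compress (Function.invFunOn D.compress (peripheralSpace D.θ : Set D.B) x *
    Function.invFunOn D.compress (peripheralSpace D.θ : Set D.B) y)

end VNDilation

end

/-!
# Minimal dilations and the peripheral spectrum of a normal completely positive map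

**Minimal dilations.** Write `p` for the projection of `K` onto `H`. Since `τ` is unital, `θ(p) ≥ p`
(`theta_proj_mul_proj`), so that compression intertwines `θ` and `τ`, and the projections `θⁿ(p)`
increase to `1` by minimality (`tendsto_iter_proj`). If `τ(x) = λx` with `|λ| = 1`, then the operators
`λ⁻ⁿθⁿ(x)` are compressions of one another by the `θⁿ(p)`; they are bounded, hence they converge
strongly, to an eigenvector of `θ` whose compression is `x` (`exists_lift`). The compression is
isometric on the peripheral space of `θ`: for a finite sum `z` of eigenvectors, some powers `θᵐ`, with
`m` arbitrarily large, nearly fix `z`, and `θᵐ(p) θᵐ(z) θᵐ(p) = θᵐ(pzp)` has norm at most `‖pzp‖`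
(`norm_le_norm_compress_of_mem_span`). An isometry with a dense, hence full, range is a bijection
(`bijOn_compress`). The limit formula for the product is the product of the strong limits that define
the lifts (`tendsto_peripheralMul`). An invariant faithful state forces equality in the
Kadison–Schwarz inequality at the eigenvectors, which puts them in the multiplicative domain of `τ`
(`map_mul_of_faithful`).

**Existence.** The inner products of the words `θⁿ(xₙ) ⋯ θ(x₁)h` are prescribed by a kernel on lists of
elements of `A` (`wordKernel`), which is positive because `τ` is completely positive; its Kolmogorov
decomposition gives operators `W(s) : H → K` with total range. The commutant of `A` acts on `K` by
`W(s)h ↦ W(s)ch`; the algebra `B` is the commutant of this action, and the operators `w : H → K` that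
intertwine it satisfy `w⋆w' ∈ A` and `ww'⋆ ∈ B`. The endomorphism is `θ(b)Θ(w) = Θ(bw)`, where
`Θ(w)⋆Θ(w') = τ(w⋆w')` and `Θ(W(s)x) = W(xs)`. The operators `Θ(w)` live at first in the space of the
kernel `τ(w⋆w')` on all intertwiners, which contains `K`. That it is no larger is where normality of
`τ` enters (`comp_eq_zero_of_comp_frameOp_eq_zero`): with `G` a finite sum of operators `W(s)W(s)⋆`,
the operators `G(1 + G)⁻¹w` are combinations of operators `W(s)x`, and `w⋆(1 + G)⁻¹w` decreases to
`0`. The same description of `B` yields minimality: an operator commuting with all `θⁿ(x)` comes from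
the commutant of `A` (`isMinimal_of_word_eq`).

Normality is used in the form that an increasing net has supremum `a` if and only if it converges to
`a` in the sense of quadratic forms (`exists_re_inner_lt_of_isLUB`,
`isLUB_of_forall_exists_re_inner_lt`).
-/

set_option linter.unusedSectionVars false

/-! ### Strong limits in von Neumann algebras -/

namespace VonNeumannAlgebra

variable {H : Type u} [NormedAddCommGroup H] [InnerProductSpace ℂ H] [CompleteSpace H]

theorem mem_of_forall_commutant {A : VonNeumannAlgebra H} {z : H →L[ℂ] H}
    (h : ∀ c ∈ A.commutant, c * z = z * c) : z ∈ A := by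
  rw [← A.commutant_commutant, mem_commutant_iff]
  exact h

/-- A von Neumann algebra is closed under pointwise limits. -/
theorem mem_of_tendsto {A : VonNeumannAlgebra H} {ι : Type*} {l : Filter ι} [l.NeBot]
    {z : H →L[ℂ] H} (f : ι → H →L[ℂ] H) (hf : ∀ i, f i ∈ A)
    (h : ∀ v, Tendsto (fun i => f i v) l (𝓝 (z v))) : z ∈ A := by
  refine mem_of_forall_commutant fun c hc => ?_
  ext v
  refine tendsto_nhds_unique (((c.continuous.tendsto _).comp (h v))) ?_
  refine Tendsto.congr (fun i => ?_) (h (c v))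
  exact (congrArg (fun T : H →L[ℂ] H => T v) ((mem_commutant_iff.1 hc) _ (hf i)))

end VonNeumannAlgebra

/-! ### Simultaneous recurrence of powers of unimodular numbers -/

/-- By compactness of the torus, finitely many unimodular numbers have simultaneous powers arbitrarily
close to `1`, with arbitrarily large exponents. -/
theorem frequently_pow_near_one {k : ℕ} (c : Fin k → ℂ) (hc : ∀ i, ‖c i‖ = 1) {ε : ℝ}
    (hε : 0 < ε) : ∃ᶠ m : ℕ in atTop, ∀ i, ‖c i ^ m - 1‖ < ε := by
  obtain ⟨a, -, φ, hφ, hlim⟩ := (isCompact_closedBall (0 : Fin k → ℂ) 1).tendsto_subseq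
    (x := fun m i => c i ^ m) (fun m => by
      rw [mem_closedBall_zero_iff, pi_norm_le_iff_of_nonneg zero_le_one]
      intro i
      simp [hc])
  obtain ⟨N, hN⟩ := (Metric.cauchySeq_iff.1 hlim.cauchySeq) ε hε
  rw [frequently_atTop]
  intro M
  obtain ⟨j, hj⟩ := ((hφ.tendsto_atTop).eventually_ge_atTop (φ N + M)).and
    (eventually_ge_atTop N) |>.exists
  refine ⟨φ j - φ N, by omega, fun i => ?_⟩
  have h1 : ‖c i ^ φ j - c i ^ φ N‖ < ε := by
    have := hN j hj.2 N le_rfl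
    rw [dist_eq_norm] at this
    exact (norm_le_pi_norm (fun i => c i ^ φ j - c i ^ φ N) i).trans_lt this
  have h2 : c i ^ φ j = c i ^ (φ j - φ N) * c i ^ φ N := by
    rw [← pow_add]; congr 1; omega
  rw [h2, ← sub_one_mul, norm_mul, norm_pow, hc, one_pow, mul_one] at h1
  exact h1

noncomputable section

namespace VNDilation

variable {H : Type u} [NormedAddCommGroup H] [InnerProductSpace ℂ H] [CompleteSpace H]
  {A : VonNeumannAlgebra H} {τ : A →CP A} (D : VNDilation τ)

/-! ### Elementary properties of the embedding and the compression -/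

/-- The inclusion `H → K` as a bounded operator. -/
abbrev incl : H →L[ℂ] D.K := D.ι.toContinuousLinearMap

theorem adjoint_incl_incl (h : H) : D.incl.adjoint (D.incl h) = h := by
  refine ext_inner_left ℂ fun k => ?_
  rw [ContinuousLinearMap.adjoint_inner_right]
  exact D.ι.inner_map_map k h

theorem embed_apply (a : A) (v : D.K) :
    (D.embed a : D.K →L[ℂ] D.K) v = D.incl ((a : H →L[ℂ] H) (D.incl.adjoint v)) := rfl

theorem compress_apply (b : D.B) (h : H) :
    (D.compress b : H →L[ℂ] H) h = D.incl.adjoint ((b : D.K →L[ℂ] D.K) (D.incl h)) := rfl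

@[simp]
theorem compress_embed (a : A) : D.compress (D.embed a) = a := by
  refine Subtype.ext (ContinuousLinearMap.ext fun h => ?_)
  simp [compress_apply, embed_apply, -LinearIsometry.coe_toContinuousLinearMap,
    adjoint_incl_incl]

theorem embed_mul (a b : A) : D.embed (a * b) = D.embed a * D.embed b := by
  refine Subtype.ext (ContinuousLinearMap.ext fun h => ?_)
  change _ = (D.embed a : D.K →L[ℂ] D.K) ((D.embed b : D.K →L[ℂ] D.K) h)
  simp only [embed_apply, adjoint_incl_incl]
  rfl

theorem embed_smul (c : ℂ) (a : A) : D.embed (c • a) = c • D.embed a := by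
  refine Subtype.ext (ContinuousLinearMap.ext fun h => ?_)
  change D.incl (c • (a : H →L[ℂ] H) (D.incl.adjoint h)) = c • _
  rw [map_smul]
  rfl

theorem embed_star (a : A) : D.embed (star a) = star (D.embed a) := by
  refine Subtype.ext ?_
  change D.incl ∘L star (a : H →L[ℂ] H) ∘L D.incl.adjoint
    = star (D.incl ∘L (a : H →L[ℂ] H) ∘L D.incl.adjoint)
  simp only [ContinuousLinearMap.star_eq_adjoint, ContinuousLinearMap.adjoint_comp,
    ContinuousLinearMap.adjoint_adjoint]
  rfl

theorem norm_incl_le : ‖D.incl‖ ≤ 1 := D.ι.norm_toContinuousLinearMap_le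

theorem norm_adjoint_incl_le : ‖D.incl.adjoint‖ ≤ 1 := by
  rw [LinearIsometryEquiv.norm_map]
  exact D.norm_incl_le

theorem norm_embed_le (a : A) : ‖D.embed a‖ ≤ ‖a‖ := by
  change ‖D.incl ∘L (a : H →L[ℂ] H) ∘L D.incl.adjoint‖ ≤ ‖(a : H →L[ℂ] H)‖
  calc _ ≤ ‖D.incl‖ * (‖(a : H →L[ℂ] H)‖ * ‖D.incl.adjoint‖) :=
        (ContinuousLinearMap.opNorm_comp_le _ _).trans
          (mul_le_mul_of_nonneg_left (ContinuousLinearMap.opNorm_comp_le _ _) (norm_nonneg _))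
    _ ≤ 1 * (‖(a : H →L[ℂ] H)‖ * 1) := by
        gcongr
        · exact D.norm_incl_le
        · exact D.norm_adjoint_incl_le
    _ = _ := by ring

theorem norm_compress_le (b : D.B) : ‖D.compress b‖ ≤ ‖b‖ := by
  change ‖D.incl.adjoint ∘L (b : D.K →L[ℂ] D.K) ∘L D.incl‖ ≤ ‖(b : D.K →L[ℂ] D.K)‖
  calc _ ≤ ‖D.incl.adjoint‖ * (‖(b : D.K →L[ℂ] D.K)‖ * ‖D.incl‖) :=
        (ContinuousLinearMap.opNorm_comp_le _ _).trans
          (mul_le_mul_of_nonneg_left (ContinuousLinearMap.opNorm_comp_le _ _) (norm_nonneg _))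
    _ ≤ 1 * (‖(b : D.K →L[ℂ] D.K)‖ * 1) := by
        gcongr
        · exact D.norm_adjoint_incl_le
        · exact D.norm_incl_le
    _ = _ := by ring

/-- The compression `T : B → A` as a bounded linear map. -/
def compressL : D.B →L[ℂ] A :=
  LinearMap.mkContinuous
    { toFun := D.compress
      map_add' := fun a b => by
        refine Subtype.ext (ContinuousLinearMap.ext fun h => ?_)
        change D.incl.adjoint ((a : D.K →L[ℂ] D.K) (D.incl h) + (b : D.K →L[ℂ] D.K) (D.incl h)) = _
        rw [map_add]
        rfl
      map_smul' := fun c b => by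
        refine Subtype.ext (ContinuousLinearMap.ext fun h => ?_)
        change D.incl.adjoint (c • (b : D.K →L[ℂ] D.K) (D.incl h)) = _
        rw [map_smul]
        rfl } 1
    (fun b => by simpa using D.norm_compress_le b)

@[simp]
theorem compressL_apply (b : D.B) : D.compressL b = D.compress b := rfl

theorem proj_mul_embed (a : A) : D.embed 1 * D.embed a = D.embed a := by
  rw [← embed_mul, one_mul]

theorem star_proj : star (D.embed 1) = D.embed 1 := by
  rw [← embed_star, star_one]

theorem embed_compress (b : D.B) : D.embed (D.compress b) = D.embed 1 * b * D.embed 1 := rfl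

/-! ### The iterates of the endomorphism -/

/-- The iterate `θⁿ` as a `*`-endomorphism of `B`. -/
def iter : ℕ → (D.B →⋆ₐ[ℂ] D.B)
  | 0 => StarAlgHom.id ℂ D.B
  | n + 1 => (iter n).comp D.θ

theorem iter_apply (n : ℕ) (b : D.B) : D.iter n b = D.θ^[n] b := by
  induction n generalizing b with
  | zero => rfl
  | succ n ih => exact ih _

theorem iter_add (m n : ℕ) (b : D.B) : D.iter (m + n) b = D.iter m (D.iter n b) := by
  simp only [iter_apply, Function.iterate_add_apply]

theorem iter_one (b : D.B) : D.iter 1 b = D.θ b := rfl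

theorem iter_eigen {b : D.B} {c : ℂ} (h : D.θ b = c • b) (n : ℕ) : D.iter n b = c ^ n • b := by
  induction n with
  | zero => simp [iter_apply]
  | succ n ih =>
    rw [add_comm, iter_add, ih, iter_one, map_smul, h, smul_smul, pow_add, pow_one, mul_comm]

theorem iterate_eigen {M : Type*} [AddCommMonoid M] [Module ℂ M] {F : Type*} [FunLike F M M]
    [LinearMapClass F ℂ M M] (f : F) {b : M} {c : ℂ} (h : f b = c • b) (n : ℕ) :
    f^[n] b = c ^ n • b := by
  induction n with
  | zero => simp
  | succ n ih =>
    rw [Function.iterate_succ_apply', ih, map_smul, h, smul_smul, pow_succ]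

theorem norm_iter_le (n : ℕ) (b : D.B) : ‖D.iter n b‖ ≤ ‖b‖ :=
  NonUnitalStarAlgHom.norm_apply_le _ _

theorem compress_iter_embed (n : ℕ) (a : A) : D.compress (D.iter n (D.embed a)) = τ^[n] a := by
  rw [iter_apply]
  exact Subtype.ext (D.dilates n a).symm

variable {D}

/-- If `τ` is unital, then `θ(p) ≥ p`. -/
theorem theta_proj_mul_proj (hunital : τ 1 = 1) : D.θ (D.embed 1) * D.embed 1 = D.embed 1 := by
  set q := D.θ (D.embed 1) with hq
  have hqs : star q = q := by rw [hq, ← map_star, star_proj]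
  have hqq : q * q = q := by rw [hq, ← map_mul, proj_mul_embed]
  have hcomp : D.compress q = 1 := by
    have := D.compress_iter_embed 1 1
    simpa [iter_one, hunital] using this
  have key : (q - 1) * D.embed 1 = 0 := by
    rw [← CStarRing.star_mul_self_eq_zero_iff]
    have h1 : star ((q - 1) * D.embed 1) * ((q - 1) * D.embed 1)
        = D.embed 1 * D.embed 1 - D.embed 1 * q * D.embed 1 := by
      rw [star_mul, star_sub, hqs, star_proj, star_one]
      have : (q - 1) * (q - 1) = 1 - q := by
        rw [sub_mul, mul_sub, hqq]; simp
      calc _ = D.embed 1 * ((q - 1) * (q - 1)) * D.embed 1 := by noncomm_ring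
        _ = _ := by rw [this]; noncomm_ring
    rw [h1, ← embed_compress, hcomp, proj_mul_embed, sub_self]
  rw [sub_mul, one_mul, sub_eq_zero] at key
  exact key

theorem iter_proj_mul_proj (hunital : τ 1 = 1) (n : ℕ) :
    D.iter n (D.embed 1) * D.embed 1 = D.embed 1 := by
  induction n with
  | zero => simp [iter_apply, proj_mul_embed]
  | succ n ih =>
    have h1 : D.iter (n + 1) (D.embed 1) * D.iter n (D.embed 1) = D.iter n (D.embed 1) := by
      rw [iter_add, ← map_mul, iter_one, theta_proj_mul_proj hunital]
    calc D.iter (n + 1) (D.embed 1) * D.embed 1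
        = D.iter (n + 1) (D.embed 1) * (D.iter n (D.embed 1) * D.embed 1) := by rw [ih]
      _ = D.embed 1 := by rw [← mul_assoc, h1, ih]

theorem iter_proj_mul_iter_proj (hunital : τ 1 = 1) {m n : ℕ} (h : m ≤ n) :
    D.iter n (D.embed 1) * D.iter m (D.embed 1) = D.iter m (D.embed 1) := by
  obtain ⟨k, rfl⟩ := Nat.exists_eq_add_of_le h
  rw [iter_add, ← map_mul, iter_proj_mul_proj hunital]

theorem star_iter_proj (n : ℕ) : star (D.iter n (D.embed 1)) = D.iter n (D.embed 1) := by
  rw [← map_star, star_proj]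

/-- The compression intertwines `θ` and `τ`, because `θ(p) ≥ p`. -/
theorem compress_theta (hunital : τ 1 = 1) (b : D.B) : D.compress (D.θ b) = τ (D.compress b) := by
  have h1 := D.compress_iter_embed 1 (D.compress b)
  have h2 : D.θ (D.embed 1) * D.embed 1 = D.embed 1 := theta_proj_mul_proj hunital
  have h3 : D.embed 1 * D.θ (D.embed 1) = D.embed 1 := by
    have := congrArg star h2
    rwa [star_mul, ← map_star, star_proj] at this
  rw [iter_one, embed_compress, map_mul, map_mul] at h1
  have h4 : ∀ c : D.B, D.compress c = D.compress (D.embed 1 * c * D.embed 1) := fun c => by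
    rw [← embed_compress, compress_embed]
  have h1' : D.compress (D.θ (D.embed 1) * D.θ b * D.θ (D.embed 1)) = τ (D.compress b) := h1
  rw [← h1', h4 (D.θ b), h4 (D.θ _ * _ * _)]
  congr 1
  calc D.embed 1 * D.θ b * D.embed 1
      = (D.embed 1 * D.θ (D.embed 1)) * D.θ b * (D.θ (D.embed 1) * D.embed 1) := by rw [h2, h3]
    _ = _ := by noncomm_ring

/-! ### The projections `θⁿ(p)` increase to the identity -/

/-- The projection `θⁿ(p)` fixes the words of length at most `n`. -/
theorem iter_proj_word (hunital : τ 1 = 1) (l : List A) (h : H) {n : ℕ} (hn : l.length ≤ n) :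
    (D.iter n (D.embed 1) : D.K →L[ℂ] D.K) (D.word l h) = D.word l h := by
  cases l with
  | nil =>
    have h1 : (D.embed 1 : D.K →L[ℂ] D.K) (D.ι h) = D.ι h := by
      change D.incl (D.incl.adjoint (D.incl h)) = D.incl h
      rw [adjoint_incl_incl]
    have h2 := congrArg (fun b : D.B => (b : D.K →L[ℂ] D.K) (D.ι h))
      (iter_proj_mul_proj (D := D) hunital n)
    change (D.iter n (D.embed 1) : D.K →L[ℂ] D.K) ((D.embed 1 : D.K →L[ℂ] D.K) (D.ι h)) = _ at h2
    rw [h1] at h2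
    exact h2
  | cons x l =>
    have h2 : D.iter n (D.embed 1) * D.iter (l.length + 1) (D.embed x)
        = D.iter (l.length + 1) (D.embed x) := by
      conv_lhs => rw [← D.proj_mul_embed x, map_mul, ← mul_assoc,
        iter_proj_mul_iter_proj hunital (m := l.length + 1) hn, ← map_mul, D.proj_mul_embed]
    have h3 := congrArg (fun b : D.B => (b : D.K →L[ℂ] D.K) (D.word l h)) h2
    simp only [iter_apply] at h3 ⊢
    exact h3

theorem norm_iter_proj_apply_le (n : ℕ) (v : D.K) :
    ‖(D.iter n (D.embed 1) : D.K →L[ℂ] D.K) v‖ ≤ ‖v‖ := by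
  have h1 : ‖(D.iter n (D.embed 1) : D.K →L[ℂ] D.K)‖ ≤ 1 := by
    refine (D.norm_iter_le n _).trans ((D.norm_embed_le 1).trans ?_)
    exact ContinuousLinearMap.norm_id_le
  simpa using (ContinuousLinearMap.le_opNorm _ v).trans
    (mul_le_mul_of_nonneg_right h1 (norm_nonneg v))

theorem tendsto_iter_proj (hunital : τ 1 = 1) (hD : D.IsMinimal) (v : D.K) :
    Tendsto (fun n => (D.iter n (D.embed 1) : D.K →L[ℂ] D.K) v) atTop (𝓝 v) := by
  have hspan : ∀ u ∈ Submodule.span ℂ {v : D.K | ∃ (l : List A) (h : H), v = D.word l h},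
      ∃ N : ℕ, ∀ n ≥ N, (D.iter n (D.embed 1) : D.K →L[ℂ] D.K) u = u := by
    intro u hu
    induction hu using Submodule.span_induction with
    | mem u hu =>
      obtain ⟨l, h, rfl⟩ := hu
      exact ⟨l.length, fun n hn => iter_proj_word hunital l h hn⟩
    | zero => exact ⟨0, fun n _ => map_zero _⟩
    | add x y _ _ hx hy =>
      obtain ⟨N, hN⟩ := hx
      obtain ⟨M, hM⟩ := hy
      refine ⟨max N M, fun n hn => ?_⟩
      rw [map_add, hN n (le_of_max_le_left hn), hM n (le_of_max_le_right hn)]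
    | smul c x _ hx =>
      obtain ⟨N, hN⟩ := hx
      exact ⟨N, fun n hn => by rw [map_smul, hN n hn]⟩
  have hv : v ∈ closure (Submodule.span ℂ {v : D.K | ∃ (l : List A) (h : H), v = D.word l h} :
      Set D.K) := by
    rw [← Submodule.topologicalClosure_coe, hD.space]
    trivial
  rw [Metric.tendsto_atTop]
  intro ε hε
  obtain ⟨u, hu, huv⟩ := Metric.mem_closure_iff.1 hv (ε / 2) (half_pos hε)
  obtain ⟨N, hN⟩ := hspan u hu
  refine ⟨N, fun n hn => ?_⟩
  have h1 : (D.iter n (D.embed 1) : D.K →L[ℂ] D.K) v - v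
      = (D.iter n (D.embed 1) : D.K →L[ℂ] D.K) (v - u) - (v - u) := by
    rw [map_sub, hN n hn]; abel
  rw [dist_eq_norm] at huv ⊢
  rw [h1]
  calc _ ≤ ‖(D.iter n (D.embed 1) : D.K →L[ℂ] D.K) (v - u)‖ + ‖v - u‖ := norm_sub_le _ _
    _ ≤ ‖v - u‖ + ‖v - u‖ := by gcongr; exact norm_iter_proj_apply_le n _
    _ < ε := by linarith

theorem tendsto_iter_proj_compress (hunital : τ 1 = 1) (hD : D.IsMinimal) (b : D.B) (v : D.K) :
    Tendsto (fun n => ((D.iter n (D.embed 1) * b * D.iter n (D.embed 1) : D.B) :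
      D.K →L[ℂ] D.K) v) atTop (𝓝 ((b : D.K →L[ℂ] D.K) v)) := by
  have h1 := ((b : D.K →L[ℂ] D.K).continuous.tendsto v).comp (tendsto_iter_proj hunital hD v)
  have h2 := tendsto_iter_proj hunital hD ((b : D.K →L[ℂ] D.K) v)
  rw [tendsto_iff_norm_sub_tendsto_zero] at h1 h2 ⊢
  refine squeeze_zero (fun _ => norm_nonneg _) (fun n => ?_) (by simpa using h1.add h2)
  set q := (D.iter n (D.embed 1) : D.K →L[ℂ] D.K) with hq
  set b' := (b : D.K →L[ℂ] D.K)
  change ‖q (b' (q v)) - b' v‖ ≤ ‖b' (q v) - b' v‖ + ‖q (b' v) - b' v‖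
  have : q (b' (q v)) - b' v = q (b' (q v) - b' v) + (q (b' v) - b' v) := by
    rw [map_sub]; abel
  rw [this]
  refine (norm_add_le _ _).trans ?_
  gcongr
  exact norm_iter_proj_apply_le n _

/-- The cut-downs by `θⁿ⁺¹(p)` determine an element of `B`; the shift by one allows for elements of
the form `θ(z)`. -/
theorem eq_of_forall_compress_eq (hunital : τ 1 = 1) (hD : D.IsMinimal) {b c : D.B}
    (h : ∀ n, D.iter (n + 1) (D.embed 1) * b * D.iter (n + 1) (D.embed 1)
      = D.iter (n + 1) (D.embed 1) * c * D.iter (n + 1) (D.embed 1)) : b = c := by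
  refine Subtype.ext (ContinuousLinearMap.ext fun v => ?_)
  refine tendsto_nhds_unique
    ((tendsto_add_atTop_iff_nat 1).2 (tendsto_iter_proj_compress hunital hD b v)) ?_
  simp_rw [h]
  exact (tendsto_add_atTop_iff_nat 1).2 (tendsto_iter_proj_compress hunital hD c v)

/-! ### Lifting peripheral eigenvectors -/

/-- The operators `λ⁻ⁿ θⁿ(x)` of which the lift of an eigenvector `x` is the strong limit. -/
def liftSeq (D : VNDilation τ) (lam : ℂ) (x : A) (n : ℕ) : D.B :=
  (lam ^ n)⁻¹ • D.iter n (D.embed x)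

theorem norm_liftSeq_le {lam : ℂ} (hlam : ‖lam‖ = 1) (x : A) (n : ℕ) :
    ‖D.liftSeq lam x n‖ ≤ ‖x‖ := by
  rw [liftSeq, norm_smul, norm_inv, norm_pow, hlam, one_pow, inv_one, one_mul]
  exact (D.norm_iter_le n _).trans (D.norm_embed_le x)

theorem norm_liftSeq_apply_le {lam : ℂ} (hlam : ‖lam‖ = 1) (x : A) (n : ℕ) (v : D.K) :
    ‖(D.liftSeq lam x n : D.K →L[ℂ] D.K) v‖ ≤ ‖x‖ * ‖v‖ :=
  (ContinuousLinearMap.le_opNorm _ v).trans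
    (mul_le_mul_of_nonneg_right (norm_liftSeq_le hlam x n) (norm_nonneg v))

theorem iter_proj_mul_liftSeq {lam : ℂ} (hlam : ‖lam‖ = 1) {x : A} (hx : τ x = lam • x) {m n : ℕ}
    (h : m ≤ n) : D.iter m (D.embed 1) * D.liftSeq lam x n * D.iter m (D.embed 1)
      = D.liftSeq lam x m := by
  have hlam0 : lam ≠ 0 := fun h0 => by simp [h0] at hlam
  obtain ⟨k, rfl⟩ := Nat.exists_eq_add_of_le h
  rw [liftSeq, mul_smul_comm, smul_mul_assoc, iter_add, ← map_mul, ← map_mul, ← embed_compress,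
    compress_iter_embed, iterate_eigen τ hx, embed_smul, map_smul, smul_smul, liftSeq, pow_add]
  congr 1
  field_simp

theorem iter_proj_mul_liftSeq_self (lam : ℂ) (x : A) (n : ℕ) :
    D.iter n (D.embed 1) * D.liftSeq lam x n = D.liftSeq lam x n := by
  rw [liftSeq, mul_smul_comm, ← map_mul, proj_mul_embed]

/-- The sequence `λ⁻ⁿ θⁿ(x)` is strongly Cauchy: on the range of `θᵐ(p)`, each term (from the
`m`-th on) is a compression of every later one, so the norms increase. -/
theorem cauchySeq_liftSeq (hunital : τ 1 = 1) (hD : D.IsMinimal) {lam : ℂ} (hlam : ‖lam‖ = 1)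
    {x : A} (hx : τ x = lam • x) (v : D.K) :
    CauchySeq fun n => (D.liftSeq lam x n : D.K →L[ℂ] D.K) v := by
  set z := fun n => (D.liftSeq lam x n : D.K →L[ℂ] D.K) with hz
  set q := fun n => (D.iter n (D.embed 1) : D.K →L[ℂ] D.K) with hq
  have hq_sa : ∀ n a b, inner ℂ (q n a) b = inner ℂ a (q n b) := fun n a b => by
    have h1 : ContinuousLinearMap.adjoint (q n) = q n :=
      congrArg (fun b : D.B => (b : D.K →L[ℂ] D.K)) (star_iter_proj (D := D) n)
    rw [← ContinuousLinearMap.adjoint_inner_right, h1]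
  have key : ∀ u m, q m u = u → ∀ i j, m ≤ i → i ≤ j → z i u = q i (z j u) := by
    intro u m hu i j hmi hij
    have h1 : q i u = u := by
      rw [← hu]
      exact congrArg (fun b : D.B => (b : D.K →L[ℂ] D.K) u)
        (iter_proj_mul_iter_proj (D := D) hunital hmi)
    have h2 : q i (z j (q i u)) = z i u := congrArg (fun b : D.B => (b : D.K →L[ℂ] D.K) u)
        (iter_proj_mul_liftSeq (D := D) hlam hx hij)
    rw [h1] at h2
    exact h2.symm
  have hdiff : ∀ u m, q m u = u → ∀ i j, m ≤ i → i ≤ j →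
      ‖z j u - z i u‖ ^ 2 = ‖z j u‖ ^ 2 - ‖z i u‖ ^ 2 := by
    intro u m hu i j hmi hij
    have h1 := key u m hu i j hmi hij
    have h2 : inner ℂ (z j u) (z i u) = inner ℂ (z i u) (z i u) := by
      have h3 : q i (z i u) = z i u :=
        congrArg (fun b : D.B => (b : D.K →L[ℂ] D.K) u) (iter_proj_mul_liftSeq_self lam x i)
      calc inner ℂ (z j u) (z i u) = inner ℂ (z j u) (q i (z i u)) := by rw [h3]
        _ = inner ℂ (q i (z j u)) (z i u) := (hq_sa i _ _).symm
        _ = _ := by rw [← h1]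
    rw [@norm_sub_sq ℂ, h2, inner_self_eq_norm_sq_to_K]
    norm_cast
    ring
  have hcauchy : ∀ u m, q m u = u → CauchySeq fun n => z n u := by
    intro u m hu
    have hmono : Monotone fun n => ‖z (n + m) u‖ ^ 2 := fun i j hij => by
      have := hdiff u m hu (i + m) (j + m) (by omega) (by omega)
      have h2 := sq_nonneg ‖z (j + m) u - z (i + m) u‖
      change ‖z (i + m) u‖ ^ 2 ≤ ‖z (j + m) u‖ ^ 2
      linarith
    have hbdd : BddAbove (Set.range fun n => ‖z (n + m) u‖ ^ 2) := by
      refine ⟨(‖x‖ * ‖u‖) ^ 2, ?_⟩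
      rintro _ ⟨n, rfl⟩
      have := norm_liftSeq_apply_le (D := D) hlam x (n + m) u
      change ‖z (n + m) u‖ ^ 2 ≤ _
      gcongr
    have hc := (tendsto_atTop_ciSup hmono hbdd).cauchySeq
    rw [Metric.cauchySeq_iff'] at hc ⊢
    intro ε hε
    obtain ⟨N, hN⟩ := hc (ε ^ 2) (by positivity)
    refine ⟨N + m, fun n hn => ?_⟩
    have h1 := hN (n - m) (by omega)
    rw [Real.dist_eq, Nat.sub_add_cancel (by omega)] at h1
    rw [dist_eq_norm]
    refine lt_of_pow_lt_pow_left₀ 2 hε.le ?_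
    rw [hdiff u m hu (N + m) n (by omega) hn]
    exact (le_abs_self _).trans_lt h1
  rw [Metric.cauchySeq_iff]
  intro ε hε
  have hx0 : 0 < ‖x‖ + 1 := by positivity
  obtain ⟨m, hm⟩ := ((Metric.tendsto_atTop.1 (tendsto_iter_proj hunital hD v))
    (ε / (3 * (‖x‖ + 1))) (by positivity))
  have hm := hm m le_rfl
  set u := q m v with hu
  have huu : q m u = u := congrArg (fun b : D.B => (b : D.K →L[ℂ] D.K) v)
    (iter_proj_mul_iter_proj (D := D) hunital (le_refl m))
  obtain ⟨N, hN⟩ := (Metric.cauchySeq_iff.1 (hcauchy u m huu)) (ε / 3) (by positivity)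
  refine ⟨N, fun i hi j hj => ?_⟩
  have hb : ∀ i, dist (z i v) (z i u) < ε / 3 := fun i => by
    rw [dist_eq_norm, ← map_sub]
    have h1 : ‖v - u‖ < ε / (3 * (‖x‖ + 1)) := by rwa [← dist_eq_norm, dist_comm]
    calc _ ≤ ‖x‖ * ‖v - u‖ := norm_liftSeq_apply_le hlam x i _
      _ ≤ (‖x‖ + 1) * ‖v - u‖ := by gcongr; linarith
      _ < (‖x‖ + 1) * (ε / (3 * (‖x‖ + 1))) := by gcongr
      _ = ε / 3 := by field_simp
  calc dist (z i v) (z j v) ≤ dist (z i v) (z i u) + dist (z i u) (z j u) + dist (z j u) (z j v) :=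
        dist_triangle4 _ _ _ _
    _ < ε / 3 + ε / 3 + ε / 3 := by
        have h1 := hb i
        have h2 := hb j
        rw [dist_comm] at h2
        have h3 := hN i hi j hj
        linarith
    _ = ε := by ring

/-- Every peripheral eigenvector `x` of `τ` is the compression of an eigenvector of `θ`, which is
the strong limit of `λ⁻ⁿ θⁿ(x)`. -/
theorem exists_lift (hunital : τ 1 = 1) (hD : D.IsMinimal) {lam : ℂ} (hlam : ‖lam‖ = 1)
    {x : A} (hx : τ x = lam • x) :
    ∃ z : D.B, D.θ z = lam • z ∧ D.compress z = x ∧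
      ∀ v, Tendsto (fun n => (D.liftSeq lam x n : D.K →L[ℂ] D.K) v) atTop
        (𝓝 ((z : D.K →L[ℂ] D.K) v)) := by
  have hlam0 : lam ≠ 0 := fun h0 => by simp [h0] at hlam
  choose f hf using fun v => cauchySeq_tendsto_of_complete
    (cauchySeq_liftSeq (D := D) hunital hD hlam hx v)
  set z0 : D.K →L[ℂ] D.K := continuousLinearMapOfTendsto
    (fun n => (D.liftSeq lam x n : D.K →L[ℂ] D.K)) (tendsto_pi_nhds.2 hf) with hz0
  have hlim : ∀ v, Tendsto (fun n => (D.liftSeq lam x n : D.K →L[ℂ] D.K) v) atTop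
      (𝓝 (z0 v)) := hf
  set z : D.B := ⟨z0, VonNeumannAlgebra.mem_of_tendsto _ (fun n => (D.liftSeq lam x n).2) hlim⟩
  have hcut : ∀ m, D.iter m (D.embed 1) * z * D.iter m (D.embed 1) = D.liftSeq lam x m := by
    intro m
    refine Subtype.ext (ContinuousLinearMap.ext fun v => ?_)
    refine tendsto_nhds_unique ((((D.iter m (D.embed 1) : D.K →L[ℂ] D.K)).continuous.tendsto
      _).comp (hlim ((D.iter m (D.embed 1) : D.K →L[ℂ] D.K) v))) ?_
    refine tendsto_const_nhds.congr' ?_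
    filter_upwards [eventually_ge_atTop m] with n hn
    exact congrArg (fun b : D.B => (b : D.K →L[ℂ] D.K) v)
      (iter_proj_mul_liftSeq (D := D) hlam hx hn).symm
  refine ⟨z, ?_, ?_, hlim⟩
  · refine eq_of_forall_compress_eq hunital hD fun m => ?_
    have h1 : D.iter (m + 1) (D.embed 1) * D.θ z * D.iter (m + 1) (D.embed 1)
        = D.θ (D.liftSeq lam x m) := by
      rw [← hcut m, map_mul, map_mul, add_comm, iter_add, iter_one]
    rw [h1, mul_smul_comm, smul_mul_assoc, hcut, liftSeq, liftSeq, map_smul, smul_smul, add_comm m,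
      iter_add, iter_one]
    congr 1
    rw [pow_add, pow_one]
    field_simp
  · have h1 := hcut 0
    have h2 : D.embed (D.compress z) = D.embed x := by
      rw [embed_compress]
      simpa [iter_apply, liftSeq] using h1
    rw [← compress_embed D (D.compress z), h2, compress_embed]

/-! ### The compression is isometric on the peripheral space -/

/-- On a finite sum of peripheral eigenvectors some powers of `θ` are almost the identity, so that
`z ≈ θᵐ(z)` and the norms of `z` and `p z p` can be compared after cutting down by `θᵐ(p)`, which
tends to `1`. -/
theorem norm_le_norm_compress_of_mem_span (hunital : τ 1 = 1) (hD : D.IsMinimal) {z : D.B}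
    (hz : z ∈ Submodule.span ℂ {x : D.B | ∃ c : ℂ, ‖c‖ = 1 ∧ D.θ x = c • x}) :
    ‖z‖ ≤ ‖D.compress z‖ := by
  obtain ⟨k, f, g, hfg⟩ := Submodule.mem_span_set'.1 hz
  choose c hc hθ using fun i => (g i).2
  refine le_of_forall_pos_le_add fun ε hε => ?_
  have hS : 0 ≤ ∑ i, ‖f i • (g i : D.B)‖ := Finset.sum_nonneg fun _ _ => norm_nonneg _
  set S := ∑ i, ‖f i • (g i : D.B)‖ with hSdef
  refine ContinuousLinearMap.opNorm_le_bound _ (by positivity) fun v => ?_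
  have hlim := (tendsto_iter_proj_compress hunital hD z v).norm
  refine le_of_tendsto_of_frequently hlim ?_
  refine (frequently_pow_near_one c hc (ε := ε / (S + 1)) (by positivity)).mono fun m hm => ?_
  -- `θᵐ` maps `w` to `z`, and `w` is close to `z` because `m` is a recurrence time.
  set w : D.B := ∑ i, (c i ^ m)⁻¹ • f i • (g i : D.B) with hw
  have hc0 : ∀ i, c i ≠ 0 := fun i h0 => by have := hc i; simp [h0] at this
  have hθw : D.iter m w = z := by
    rw [hw, map_sum, ← hfg]
    refine Finset.sum_congr rfl fun i _ => ?_
    rw [map_smul, map_smul, D.iter_eigen (hθ i), smul_comm (f i), smul_smul,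
      inv_mul_cancel₀ (pow_ne_zero m (hc0 i)), one_smul]
  have hwz : ‖w - z‖ ≤ ε := by
    rw [hw, ← hfg, ← Finset.sum_sub_distrib]
    calc _ ≤ ∑ i, ‖(c i ^ m)⁻¹ • f i • (g i : D.B) - f i • (g i : D.B)‖ := norm_sum_le _ _
      _ ≤ ∑ i, ε / (S + 1) * ‖f i • (g i : D.B)‖ := by
        refine Finset.sum_le_sum fun i _ => ?_
        have h1 : (c i ^ m)⁻¹ • f i • (g i : D.B) - f i • (g i : D.B)
            = ((c i ^ m)⁻¹ * (1 - c i ^ m)) • f i • (g i : D.B) := by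
          rw [mul_sub, inv_mul_cancel₀ (pow_ne_zero m (hc0 i)), mul_one, sub_smul, one_smul]
        rw [h1, norm_smul, norm_mul, norm_inv, norm_pow, hc, one_pow, inv_one, one_mul,
          norm_sub_rev]
        gcongr
        exact (hm i).le
      _ = ε * (S / (S + 1)) := by rw [← Finset.mul_sum, ← hSdef]; ring
      _ ≤ ε * 1 := by
        gcongr
        rw [div_le_one (by positivity)]
        linarith
      _ = ε := mul_one _
  have h1 : D.iter m (D.embed 1) * z * D.iter m (D.embed 1) = D.iter m (D.embed (D.compress w)) := by
    rw [embed_compress, map_mul, map_mul, hθw]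
  rw [h1]
  refine (ContinuousLinearMap.le_opNorm _ v).trans ?_
  gcongr
  calc _ ≤ ‖D.compress w‖ := (D.norm_iter_le m _).trans (D.norm_embed_le _)
    _ = ‖D.compressL z + D.compressL (w - z)‖ := by rw [← map_add]; simp
    _ ≤ ‖D.compress z‖ + ‖w - z‖ :=
      (norm_add_le _ _).trans (add_le_add le_rfl (D.norm_compress_le _))
    _ ≤ _ := by gcongr

theorem norm_compress_of_mem_peripheralSpace (hunital : τ 1 = 1) (hD : D.IsMinimal) {z : D.B}
    (hz : z ∈ peripheralSpace D.θ) : ‖D.compress z‖ = ‖z‖ := by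
  have hcl : IsClosed {z : D.B | ‖D.compressL z‖ = ‖z‖} :=
    isClosed_eq (D.compressL.continuous.norm) continuous_norm
  exact closure_minimal (fun w hw => le_antisymm (D.norm_compress_le w)
    (norm_le_norm_compress_of_mem_span hunital hD hw)) hcl hz

theorem mem_peripheralSpace {M : Type*} [NormedAddCommGroup M] [NormedSpace ℂ M] (f : M → M)
    {c : ℂ} (hc : ‖c‖ = 1) {x : M} (hx : f x = c • x) : x ∈ peripheralSpace f :=
  Submodule.le_topologicalClosure _ (Submodule.subset_span ⟨c, hc, hx⟩)

theorem bijOn_compress (hunital : τ 1 = 1) (hD : D.IsMinimal) :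
    Set.BijOn D.compress (peripheralSpace D.θ : Set D.B) (peripheralSpace τ : Set A) := by
  refine ⟨?_, ?_, ?_⟩
  · intro z hz
    have h1 : Submodule.span ℂ {x : D.B | ∃ c : ℂ, ‖c‖ = 1 ∧ D.θ x = c • x} ≤
        (peripheralSpace τ).comap (D.compressL : D.B →ₗ[ℂ] A) := by
      rw [Submodule.span_le]
      rintro w ⟨c, hc, hw⟩
      refine mem_peripheralSpace τ hc ?_
      change τ (D.compress w) = c • D.compressL w
      rw [← compress_theta hunital, hw, ← compressL_apply, map_smul]
    have hcl : IsClosed (D.compressL ⁻¹' (peripheralSpace τ : Set A)) :=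
      (Submodule.isClosed_topologicalClosure _).preimage D.compressL.continuous
    exact closure_minimal h1 hcl hz
  · intro z hz w hw hzw
    have h1 := norm_compress_of_mem_peripheralSpace hunital hD (sub_mem hz hw)
    rw [← compressL_apply, map_sub, compressL_apply, compressL_apply, hzw, sub_self, norm_zero]
      at h1
    exact sub_eq_zero.1 (norm_eq_zero.1 h1.symm)
  -- The image of an isometry on a complete space is closed, so lifting the eigenvectors suffices.
  · have hcl : IsClosed (peripheralSpace D.θ : Set D.B) := Submodule.isClosed_topologicalClosure _
    have hc : CompleteSpace (peripheralSpace D.θ) := hcl.completeSpace_coe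
    set g : peripheralSpace D.θ →ₗ[ℂ] A :=
      (D.compressL : D.B →ₗ[ℂ] A).comp (peripheralSpace D.θ).subtype with hg
    have hiso : Isometry g := AddMonoidHomClass.isometry_of_norm g fun z =>
      norm_compress_of_mem_peripheralSpace hunital hD z.2
    have hrange : IsClosed (LinearMap.range g : Set A) := by
      rw [LinearMap.coe_range]
      exact hiso.isClosedEmbedding.isClosed_range
    have h1 : peripheralSpace τ ≤ LinearMap.range g := by
      refine Submodule.topologicalClosure_minimal _ ?_ hrange
      rw [Submodule.span_le]
      rintro x ⟨c, hc, hx⟩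
      obtain ⟨z, hz, hzx, -⟩ := exists_lift (D := D) hunital hD hc hx
      exact ⟨⟨z, mem_peripheralSpace _ hc hz⟩, hzx⟩
    intro x hx
    obtain ⟨z, hz⟩ := h1 hx
    exact ⟨z, z.2, hz⟩

/-! ### The product on the peripheral space -/

theorem invFunOn_compress (hunital : τ 1 = 1) (hD : D.IsMinimal) {z : D.B}
    (hz : z ∈ peripheralSpace D.θ) :
    Function.invFunOn D.compress (peripheralSpace D.θ : Set D.B) (D.compress z) = z :=
  (bijOn_compress hunital hD).injOn.leftInvOn_invFunOn hz

theorem tendsto_peripheralMul (hunital : τ 1 = 1) (hD : D.IsMinimal) {lam mu : ℂ}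
    (hlam : ‖lam‖ = 1) (hmu : ‖mu‖ = 1) {x y : A} (hx : τ x = lam • x) (hy : τ y = mu • y)
    (h : H) :
    Tendsto (fun n : ℕ => ((((lam * mu) ^ n)⁻¹ • τ^[n] (x * y) : A) : H →L[ℂ] H) h)
      atTop (𝓝 ((D.peripheralMul x y : H →L[ℂ] H) h)) := by
  obtain ⟨z, hz, hzx, hzlim⟩ := exists_lift (D := D) hunital hD hlam hx
  obtain ⟨w, hw, hwy, hwlim⟩ := exists_lift (D := D) hunital hD hmu hy
  have hprod : D.peripheralMul x y = D.compress (z * w) := by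
    rw [peripheralMul, ← hzx, ← hwy, invFunOn_compress hunital hD (mem_peripheralSpace _ hlam hz),
      invFunOn_compress hunital hD (mem_peripheralSpace _ hmu hw)]
  rw [hprod]
  have hterm : ∀ n : ℕ, (((lam * mu) ^ n)⁻¹ • τ^[n] (x * y) : A)
      = D.compress (D.liftSeq lam x n * D.liftSeq mu y n) := by
    intro n
    rw [liftSeq, liftSeq, smul_mul_smul_comm, ← map_mul, ← embed_mul, ← compressL_apply, map_smul,
      compressL_apply, compress_iter_embed, mul_pow, mul_inv]
  simp_rw [hterm]
  change Tendsto (fun n => D.incl.adjoint ((D.liftSeq lam x n : D.K →L[ℂ] D.K)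
    ((D.liftSeq mu y n : D.K →L[ℂ] D.K) (D.incl h)))) atTop
    (𝓝 (D.incl.adjoint ((z : D.K →L[ℂ] D.K) ((w : D.K →L[ℂ] D.K) (D.incl h)))))
  refine (D.incl.adjoint.continuous.tendsto _).comp ?_
  have h1 := hwlim (D.incl h)
  have h2 := hzlim ((w : D.K →L[ℂ] D.K) (D.incl h))
  rw [tendsto_iff_norm_sub_tendsto_zero] at h1 h2 ⊢
  refine squeeze_zero (fun _ => norm_nonneg _) (fun n => ?_)
    (by simpa using (h1.const_mul ‖x‖).add h2)
  refine (norm_sub_le_norm_sub_add_norm_sub _ ((D.liftSeq lam x n : D.K →L[ℂ] D.K)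
    ((w : D.K →L[ℂ] D.K) (D.incl h))) _).trans ?_
  refine add_le_add ?_ le_rfl
  rw [← map_sub]
  exact norm_liftSeq_apply_le hlam x n _

/-- If `y` is a peripheral eigenvector and `τ` preserves a faithful state, then `y` lies in the
multiplicative domain of `τ`: equality holds in the Kadison–Schwarz inequality
`τ(y⋆y) ≥ τ(y)⋆τ(y)`, that is, `θ(y)` maps `H` into `H`. -/
theorem map_mul_of_faithful (φ : A →ₚ[ℂ] ℂ) (hφ : ∀ a : A, 0 ≤ a → φ a = 0 → a = 0)
    (hinv : ∀ a : A, φ (τ a) = φ a) (D : VNDilation τ) {mu : ℂ} (hmu : ‖mu‖ = 1) (x : A) {y : A}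
    (hy : τ y = mu • y) : τ (x * y) = τ x * τ y := by
  set t := D.θ (D.embed y) * D.embed 1 - D.embed 1 * (D.θ (D.embed y) * D.embed 1) with ht
  have hcomp : ∀ a, D.compress (D.θ (D.embed a)) = τ a := fun a => D.compress_iter_embed 1 a
  have hcut : ∀ a, D.embed 1 * D.θ (D.embed a) * D.embed 1 = D.embed (τ a) := fun a => by
    rw [← embed_compress, hcomp]
  have hpp : D.embed 1 * D.embed 1 = D.embed 1 := D.proj_mul_embed 1
  have hcut' : D.embed 1 * D.θ (D.embed y) * D.embed 1 = mu • D.embed y := by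
    rw [hcut, hy, embed_smul]
  have hmm : star mu * mu = 1 := by
    rw [Complex.star_def, Complex.conj_mul', hmu]; simp
  have hst : star t * t = D.embed (τ (star y * y) - star y * y) := by
    have h1 : star t * t = star (D.θ (D.embed y) * D.embed 1) * (D.θ (D.embed y) * D.embed 1)
        - star (D.embed 1 * D.θ (D.embed y) * D.embed 1)
          * (D.embed 1 * D.θ (D.embed y) * D.embed 1) := by
      simp only [ht, star_sub, star_mul, star_proj]
      have h2 : ∀ c : D.B, D.embed 1 * (D.embed 1 * c) = D.embed 1 * c := fun c => by
        rw [← mul_assoc, hpp]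
      simp only [sub_mul, mul_sub, mul_assoc, h2]
      abel
    have h3 : star (D.θ (D.embed y) * D.embed 1) * (D.θ (D.embed y) * D.embed 1)
        = D.embed (τ (star y * y)) := by
      rw [← hcut, star_mul, star_proj, embed_mul, embed_star, map_mul, map_star]
      simp only [mul_assoc]
    have h5 : ∀ a b : A, D.embed (a - b) = D.embed a - D.embed b := fun a b => by
      refine Subtype.ext (ContinuousLinearMap.ext fun v => ?_)
      change D.incl ((a : H →L[ℂ] H) (D.incl.adjoint v) - (b : H →L[ℂ] H) (D.incl.adjoint v)) = _
      rw [map_sub]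
      rfl
    rw [h1, h3, hcut', star_smul, smul_mul_smul_comm, hmm, one_smul, h5, embed_mul, embed_star]
  set a := τ (star y * y) - star y * y with ha
  have hnn : 0 ≤ a := by
    have h1 : a = D.compress (star t * t) := by rw [hst, compress_embed]
    rw [h1]
    change (0 : H →L[ℂ] H) ≤ D.incl.adjoint ∘L ((star t * t : D.B) : D.K →L[ℂ] D.K) ∘L D.incl
    rw [ContinuousLinearMap.nonneg_iff_isPositive]
    have h2 : (0 : D.K →L[ℂ] D.K) ≤ ((star t * t : D.B) : D.K →L[ℂ] D.K) :=
      star_mul_self_nonneg (t : D.K →L[ℂ] D.K)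
    exact ((ContinuousLinearMap.nonneg_iff_isPositive _).1 h2).adjoint_conj D.incl
  have ha0 : a = 0 := hφ a hnn (by rw [ha, map_sub, hinv, sub_self])
  have ht0 : t = 0 := by
    rw [← CStarRing.star_mul_self_eq_zero_iff, hst, ha0]
    exact Subtype.ext (ContinuousLinearMap.ext fun v => map_zero D.incl)
  have ht1 : D.θ (D.embed y) * D.embed 1 = D.embed 1 * (D.θ (D.embed y) * D.embed 1) :=
    sub_eq_zero.1 ht0
  rw [← compress_embed D (τ (x * y)), ← compress_embed D (τ x * τ y)]
  congr 1
  rw [← hcut, embed_mul, map_mul, embed_mul, ← hcut, ← hcut]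
  calc _ = D.embed 1 * D.θ (D.embed x) * (D.θ (D.embed y) * D.embed 1) := by noncomm_ring
    _ = D.embed 1 * D.θ (D.embed x) * ((D.embed 1 * D.embed 1) *
          (D.θ (D.embed y) * D.embed 1)) := by rw [hpp, ← ht1]
    _ = _ := by noncomm_ring

/-- With an invariant faithful state, `xy` is itself an eigenvector with eigenvalue `λμ`, and the
sequence of which `x ∘ y` is the limit is constant. -/
theorem peripheralMul_eq_mul (hunital : τ 1 = 1) (hD : D.IsMinimal) (φ : A →ₚ[ℂ] ℂ)
    (hφ : ∀ a : A, 0 ≤ a → φ a = 0 → a = 0) (hinv : ∀ a : A, φ (τ a) = φ a) {lam mu : ℂ}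
    (hlam : ‖lam‖ = 1) (hmu : ‖mu‖ = 1) {x y : A} (hx : τ x = lam • x) (hy : τ y = mu • y) :
    D.peripheralMul x y = x * y := by
  have h1 : τ (x * y) = (lam * mu) • (x * y) := by
    rw [map_mul_of_faithful φ hφ hinv D hmu x hy, hx, hy, smul_mul_smul_comm]
  have h0 : lam * mu ≠ 0 := fun h0 => by
    have : ‖lam * mu‖ = 1 := by rw [norm_mul, hlam, hmu, one_mul]
    simp [h0] at this
  refine Subtype.ext (ContinuousLinearMap.ext fun h => ?_)
  refine tendsto_nhds_unique (tendsto_peripheralMul hunital hD hlam hmu hx hy h) ?_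
  simp_rw [iterate_eigen τ h1, smul_smul, inv_mul_cancel₀ (pow_ne_zero _ h0), one_smul]
  exact tendsto_const_nhds

end VNDilation

end

/-! ### Positive matrices over a C⋆-algebra of operators -/

section MatrixForms

open scoped InnerProductSpace

theorem inner_self_nonneg' {H : Type*} [NormedAddCommGroup H] [InnerProductSpace ℂ H] {x : H} :
    (0 : ℂ) ≤ inner ℂ x x := by
  rw [inner_self_eq_norm_sq_to_K, RCLike.ofReal_eq_complex_ofReal, ← Complex.ofReal_pow,
    Complex.zero_le_real]
  positivity

section Abstract

variable {X : Type*} [NonUnitalCStarAlgebra X] [PartialOrder X] [StarOrderedRing X]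

theorem CStarAlgebra.exists_eq_star_mul_self {x : X} (hx : 0 ≤ x) : ∃ c, x = star c * c :=
  CStarAlgebra.nonneg_iff_eq_star_mul_self.1 hx

/-- A self-adjoint element `x` is tested for positivity by its negative part `y`, for which
`y⋆xy = -y³`. -/
theorem IsSelfAdjoint.exists_star_mul_mul_eq_neg {x : X} (hx : IsSelfAdjoint x) :
    ∃ y : X, star y * x * y = -(y * y * y) ∧ 0 ≤ y * y * y ∧ (y * y * y = 0 → 0 ≤ x) := by
  have hN0 : 0 ≤ x⁻ := CFC.negPart_nonneg x
  have hNsa : star x⁻ = x⁻ := hN0.isSelfAdjoint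
  have hMN : x = x⁺ - x⁻ := (CFC.posPart_sub_negPart x).symm
  refine ⟨x⁻, ?_, ?_, fun hN3 => ?_⟩
  · have h1 : x⁻ * x = -(x⁻ * x⁻) := by
      calc x⁻ * x = x⁻ * (x⁺ - x⁻) := congrArg _ hMN
        _ = _ := by rw [mul_sub, CFC.negPart_mul_posPart, zero_sub]
    rw [hNsa, h1, neg_mul]
  · have := star_left_conjugate_nonneg hN0 x⁻
    rwa [hNsa] at this
  · have hN2 : x⁻ * x⁻ = 0 := by
      rw [← CStarRing.star_mul_self_eq_zero_iff, star_mul, hNsa, ← mul_assoc, hN3, zero_mul]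
    have hN1 : x⁻ = 0 := by
      rw [← CStarRing.star_mul_self_eq_zero_iff, hNsa, hN2]
    rw [hN1, sub_zero] at hMN
    exact hMN ▸ CFC.posPart_nonneg x

end Abstract

variable {R : Type*} [CStarAlgebra R] [PartialOrder R] [StarOrderedRing R]
  {H : Type*} [NormedAddCommGroup H] [InnerProductSpace ℂ H] [CompleteSpace H]
  {n : Type*} [Fintype n] (π : R →⋆ₐ[ℂ] (H →L[ℂ] H))

theorem CStarMatrix.form_star_mul_self (C : CStarMatrix n n R) (h : n → H) :
    ∑ i, ∑ j, ⟪h i, π ((star C * C) i j) (h j)⟫_ℂ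
      = ∑ k, ⟪∑ i, π (C k i) (h i), ∑ i, π (C k i) (h i)⟫_ℂ := by
  have h1 : ∀ i j, ⟪h i, π ((star C * C) i j) (h j)⟫_ℂ
      = ∑ k, ⟪π (C k i) (h i), π (C k j) (h j)⟫_ℂ := by
    intro i j
    have h2 : ((star C * C) i j : R) = ∑ k, star (C k i) * C k j := by
      rw [CStarMatrix.mul_apply]
      rfl
    rw [h2, map_sum, sum_apply, inner_sum]
    refine Finset.sum_congr rfl fun k _ => ?_
    rw [map_mul, map_star]
    exact ContinuousLinearMap.adjoint_inner_right (π (C k i)) (h i) _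
  simp_rw [h1, sum_inner, inner_sum]
  rw [Finset.sum_comm (s := Finset.univ (α := n))]
  conv_rhs => rw [Finset.sum_comm]
  rw [Finset.sum_comm]
  refine Finset.sum_congr rfl fun i _ => ?_
  rw [Finset.sum_comm]

/-- A positive matrix over an algebra of operators on `H` has a nonnegative quadratic form on
`Hⁿ`. -/
theorem CStarMatrix.form_nonneg {M : CStarMatrix n n R} (hM : 0 ≤ M) (h : n → H) :
    0 ≤ ∑ i, ∑ j, ⟪h i, π (M i j) (h j)⟫_ℂ := by
  classical
  obtain ⟨C, rfl⟩ : ∃ C : CStarMatrix n n R, M = star C * C :=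
    CStarAlgebra.exists_eq_star_mul_self hM
  rw [form_star_mul_self]
  exact Finset.sum_nonneg fun k _ => inner_self_nonneg'

/-- A positive matrix whose quadratic form is nonpositive vanishes. -/
theorem CStarMatrix.eq_zero_of_form_nonpos (hπ : Function.Injective π) {M : CStarMatrix n n R}
    (hM : 0 ≤ M) (h : ∀ h : n → H, ∑ i, ∑ j, ⟪h i, π (M i j) (h j)⟫_ℂ ≤ 0) : M = 0 := by
  classical
  obtain ⟨C, rfl⟩ : ∃ C : CStarMatrix n n R, M = star C * C :=
    CStarAlgebra.exists_eq_star_mul_self hM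
  suffices hC : C = 0 by rw [hC, mul_zero]
  refine CStarMatrix.ext fun k j => hπ (ContinuousLinearMap.ext fun v => ?_)
  have h1 := h (Pi.single j v)
  rw [form_star_mul_self] at h1
  have h2 := (Finset.sum_eq_zero_iff_of_nonneg (fun k _ => inner_self_nonneg')).1
    (le_antisymm h1 (Finset.sum_nonneg fun k _ => inner_self_nonneg')) k (Finset.mem_univ k)
  rw [inner_self_eq_zero, Finset.sum_eq_single j] at h2
  · rw [Pi.single_eq_same] at h2
    rw [h2, CStarMatrix.zero_apply, map_zero]
    rfl
  · intro i _ hij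
    rw [Pi.single_eq_of_ne hij, map_zero]
  · simp

variable {K : Type*} [NormedAddCommGroup K] [InnerProductSpace ℂ K] [CompleteSpace K]

/-- A Gram matrix `(vᵢ⋆vⱼ)` of operators `vᵢ : H → K` with entries in an algebra of operators on `H`
is positive as a matrix over that algebra. Its compression by the negative part `M⁻` is both a Gram
matrix and the negative of the positive matrix `(M⁻)³`. -/
theorem CStarMatrix.gram_nonneg (hπ : Function.Injective π) (v : n → H →L[ℂ] K)
    (M : CStarMatrix n n R) (hM : ∀ i j, π (M i j) = (v i).adjoint ∘L v j) : 0 ≤ M := by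
  classical
  have hsa : IsSelfAdjoint M := by
    refine CStarMatrix.ext fun i j => hπ ?_
    change π (star (M j i)) = π (M i j)
    rw [map_star, hM, hM, ContinuousLinearMap.star_eq_adjoint, ContinuousLinearMap.adjoint_comp,
      ContinuousLinearMap.adjoint_adjoint]
  obtain ⟨N, hcube, hpos, hM0⟩ : ∃ N : CStarMatrix n n R, star N * M * N = -(N * N * N) ∧
      0 ≤ N * N * N ∧ (N * N * N = 0 → 0 ≤ M) := hsa.exists_star_mul_mul_eq_neg
  have hform : ∀ h : n → H, 0 ≤ ∑ i, ∑ j, ⟪h i, π ((star N * M * N) i j) (h j)⟫_ℂ := by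
    intro h
    have h1 : ∀ i j, ⟪h i, π ((star N * M * N) i j) (h j)⟫_ℂ
        = ∑ l, ∑ k, ⟪v k (π (N k i) (h i)), v l (π (N l j) (h j))⟫_ℂ := by
      intro i j
      have h2 : ((star N * M * N) i j : R) = ∑ l, ∑ k, star (N k i) * M k l * N l j := by
        rw [CStarMatrix.mul_apply]
        refine Finset.sum_congr rfl fun l _ => ?_
        rw [CStarMatrix.mul_apply, Finset.sum_mul]
        rfl
      rw [h2, map_sum, sum_apply, inner_sum]
      refine Finset.sum_congr rfl fun l _ => ?_
      rw [map_sum, sum_apply, inner_sum]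
      refine Finset.sum_congr rfl fun k _ => ?_
      rw [map_mul, map_mul, map_star, hM]
      refine (ContinuousLinearMap.adjoint_inner_right (π (N k i)) (h i) _).trans ?_
      exact ContinuousLinearMap.adjoint_inner_right (v k) _ _
    have h4 : ∑ i, ∑ j, ⟪h i, π ((star N * M * N) i j) (h j)⟫_ℂ
        = ⟪∑ i, ∑ k, v k (π (N k i) (h i)), ∑ i, ∑ k, v k (π (N k i) (h i))⟫_ℂ := by
      simp_rw [h1, sum_inner, inner_sum]
      refine Finset.sum_congr rfl fun i _ => ?_
      conv_rhs => rw [Finset.sum_comm]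
      refine Finset.sum_congr rfl fun j _ => ?_
      rw [Finset.sum_comm]
    rw [h4]
    exact inner_self_nonneg'
  refine hM0 (eq_zero_of_form_nonpos π hπ hpos fun h => ?_)
  have h1 := hform h
  rw [hcube] at h1
  have h2 : ∀ i j, ⟪h i, π ((-(N * N * N)) i j) (h j)⟫_ℂ
      = -⟪h i, π ((N * N * N) i j) (h j)⟫_ℂ := fun i j => by
    change ⟪h i, π (-((N * N * N) i j)) (h j)⟫_ℂ = _
    rw [map_neg]
    exact inner_neg_right _ _
  simp_rw [h2, Finset.sum_neg_distrib] at h1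
  exact neg_nonneg.1 h1

end MatrixForms

/-- The identity representation of a von Neumann algebra. -/
noncomputable def VonNeumannAlgebra.subtype {H : Type u} [NormedAddCommGroup H]
    [InnerProductSpace ℂ H] [CompleteSpace H] (A : VonNeumannAlgebra H) :
    A →⋆ₐ[ℂ] (H →L[ℂ] H) where
  toFun := Subtype.val
  map_one' := rfl
  map_mul' _ _ := rfl
  map_zero' := rfl
  map_add' _ _ := rfl
  commutes' _ := rfl
  map_star' _ := rfl

/-! ### Total families of operators -/

section Total

open scoped InnerProductSpace

variable {S : Type*} {H K K' : Type*} [NormedAddCommGroup H] [InnerProductSpace ℂ H]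
  [CompleteSpace H] [NormedAddCommGroup K] [InnerProductSpace ℂ K] [CompleteSpace K]
  [NormedAddCommGroup K'] [InnerProductSpace ℂ K'] [CompleteSpace K']

/-- The ranges of the operators `W s : H → K` span a dense subspace of `K`. -/
def IsTotalFamily (W : S → H →L[ℂ] K) : Prop :=
  (Submodule.span ℂ {v : K | ∃ s h, W s h = v}).topologicalClosure = ⊤

theorem IsTotalFamily.ext {W : S → H →L[ℂ] K} (hW : IsTotalFamily W) {T T' : K →L[ℂ] K'}
    (h : ∀ s, T ∘L W s = T' ∘L W s) : T = T' := by
  refine ContinuousLinearMap.ext_on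
    (Submodule.dense_iff_topologicalClosure_eq_top.2 hW) ?_
  rintro _ ⟨s, v, rfl⟩
  exact congrArg (fun T : H →L[ℂ] K' => T v) (h s)

theorem IsTotalFamily.ext_left {W : S → H →L[ℂ] K} (hW : IsTotalFamily W) {T T' : K' →L[ℂ] K}
    (h : ∀ s, (W s).adjoint ∘L T = (W s).adjoint ∘L T') : T = T' := by
  apply ContinuousLinearMap.adjoint.injective
  refine hW.ext fun s => ?_
  have := congrArg ContinuousLinearMap.adjoint (h s)
  simpa only [ContinuousLinearMap.adjoint_comp, ContinuousLinearMap.adjoint_adjoint] using this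

theorem norm_sq_sum_apply (W : S → H →L[ℂ] K) (F : Finset S) (h : S → H) :
    ((‖∑ s ∈ F, W s (h s)‖ ^ 2 : ℝ) : ℂ)
      = ∑ s ∈ F, ∑ t ∈ F, ⟪h s, ((W s).adjoint ∘L W t) (h t)⟫_ℂ := by
  have h1 := inner_self_eq_norm_sq_to_K (𝕜 := ℂ) (∑ s ∈ F, W s (h s))
  push_cast
  rw [show ((‖∑ s ∈ F, W s (h s)‖ : ℂ)) ^ 2 = _ from h1.symm, sum_inner]
  refine Finset.sum_congr rfl fun s _ => ?_
  rw [inner_sum]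
  refine Finset.sum_congr rfl fun t _ => ?_
  exact (ContinuousLinearMap.adjoint_inner_right (W s) _ _).symm

/-- If `V(s)⋆V(t) + V'(s)⋆V'(t) = C² W(s)⋆W(t)` and `W` is total, then `W(s)h ↦ V(s)h` extends to
a bounded operator. -/
theorem IsTotalFamily.exists_extension {K'' : Type*} [NormedAddCommGroup K''] [InnerProductSpace ℂ K'']
    [CompleteSpace K''] {W : S → H →L[ℂ] K} (hW : IsTotalFamily W) (V : S → H →L[ℂ] K')
    (V' : S → H →L[ℂ] K'') (C : ℝ) (hC : 0 ≤ C)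
    (h : ∀ s t, (V s).adjoint ∘L V t + (V' s).adjoint ∘L V' t
      = ((C ^ 2 : ℝ) : ℂ) • ((W s).adjoint ∘L W t)) :
    ∃ T : K →L[ℂ] K', ∀ s, T ∘L W s = V s := by
  set e : (S →₀ H) →ₗ[ℂ] K := Finsupp.lsum ℂ fun s => (W s : H →ₗ[ℂ] K) with he
  set f : (S →₀ H) →ₗ[ℂ] K' := Finsupp.lsum ℂ fun s => (V s : H →ₗ[ℂ] K') with hf
  have hdense : DenseRange e := by
    have h1 : Submodule.span ℂ {v : K | ∃ s h, W s h = v} ≤ LinearMap.range e := by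
      rw [Submodule.span_le]
      rintro _ ⟨s, v, rfl⟩
      exact ⟨Finsupp.single s v, by simp [he]⟩
    exact (Submodule.dense_iff_topologicalClosure_eq_top.2 hW).mono h1
  have hnorm : ∀ x, ‖f x‖ ≤ C * ‖e x‖ := by
    intro x
    have hfx : f x = ∑ s ∈ x.support, V s (x s) := by simp [hf, Finsupp.sum]
    have hex : e x = ∑ s ∈ x.support, W s (x s) := by simp [he, Finsupp.sum]
    rw [hfx, hex]
    have h1 : ((‖∑ s ∈ x.support, V s (x s)‖ ^ 2 : ℝ) : ℂ)
        + ((‖∑ s ∈ x.support, V' s (x s)‖ ^ 2 : ℝ) : ℂ)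
        = ((C ^ 2 : ℝ) : ℂ) * ((‖∑ s ∈ x.support, W s (x s)‖ ^ 2 : ℝ) : ℂ) := by
      rw [norm_sq_sum_apply, norm_sq_sum_apply, norm_sq_sum_apply, ← Finset.sum_add_distrib,
        Finset.mul_sum]
      refine Finset.sum_congr rfl fun s _ => ?_
      rw [← Finset.sum_add_distrib, Finset.mul_sum]
      refine Finset.sum_congr rfl fun t _ => ?_
      rw [← inner_add_right, ← add_apply, h, smul_apply,
        inner_smul_right]
    have h2 : ‖∑ s ∈ x.support, V s (x s)‖ ^ 2 + ‖∑ s ∈ x.support, V' s (x s)‖ ^ 2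
        = C ^ 2 * ‖∑ s ∈ x.support, W s (x s)‖ ^ 2 := by exact_mod_cast h1
    refine le_of_sq_le_sq ?_ (by positivity)
    rw [mul_pow]
    have := sq_nonneg ‖∑ s ∈ x.support, V' s (x s)‖
    linarith
  refine ⟨f.extendOfNorm e, fun s => ContinuousLinearMap.ext fun v => ?_⟩
  have h1 := LinearMap.extendOfNorm_eq hdense ⟨C, hnorm⟩ (Finsupp.single s v)
  simpa [he, hf] using h1

end Total

/-! ### Positive kernels with values in a von Neumann algebra -/

section Kernel

open scoped InnerProductSpace

variable {S : Type u} {H : Type u} [NormedAddCommGroup H] [InnerProductSpace ℂ H]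
  [CompleteSpace H] {A : VonNeumannAlgebra H}

/-- The kernel `k` on `S` is positive: all matrices `(k sᵢ sⱼ)` are positive over `A`. -/
def IsPosKernel (k : S → S → A) : Prop :=
  ∀ (n : ℕ) (s : Fin n → S), 0 ≤ CStarMatrix.ofMatrix (Matrix.of fun i j => k (s i) (s j))

theorem IsPosKernel.star_eq {k : S → S → A} (hk : IsPosKernel k) (s t : S) :
    star (k s t) = k t s := by
  have h1 := (hk 2 ![s, t]).isSelfAdjoint
  exact congrFun (congrFun h1 1) 0

theorem IsPosKernel.form_nonneg {k : S → S → A} (hk : IsPosKernel k) (F : Finset S) (h : S → H) :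
    0 ≤ ∑ s ∈ F, ∑ t ∈ F, ⟪h s, (k s t : H →L[ℂ] H) (h t)⟫_ℂ := by
  have h1 := CStarMatrix.form_nonneg A.subtype (hk F.card fun i => (F.equivFin.symm i : S))
    (fun i => h (F.equivFin.symm i))
  change 0 ≤ ∑ i, ∑ j, ⟪h (F.equivFin.symm i),
    (k (F.equivFin.symm i) (F.equivFin.symm j) : H →L[ℂ] H) (h (F.equivFin.symm j))⟫_ℂ at h1
  rw [← Finset.sum_coe_sort F]
  simp_rw [← Finset.sum_coe_sort F (fun t => ⟪h _, (k _ t : H →L[ℂ] H) (h t)⟫_ℂ)]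
  rw [← Equiv.sum_comp F.equivFin.symm]
  refine h1.trans (le_of_eq (Finset.sum_congr rfl fun i _ => ?_))
  exact Equiv.sum_comp F.equivFin.symm fun t : F =>
    ⟪h (F.equivFin.symm i), (k (F.equivFin.symm i) t : H →L[ℂ] H) (h t)⟫_ℂ

/-- The Kolmogorov decomposition of a positive kernel. -/
theorem IsPosKernel.exists_decomposition {k : S → S → A} (hk : IsPosKernel k) :
    ∃ (K : Type u) (_ : NormedAddCommGroup K) (_ : InnerProductSpace ℂ K) (_ : CompleteSpace K)
      (W : S → H →L[ℂ] K), IsTotalFamily W ∧ ∀ s t, (W s).adjoint ∘L W t = k s t := by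
  set κ : Matrix S S (H →L[ℂ] H) := fun s t => k s t with hκ
  have hherm : κ.IsHermitian := by
    refine Matrix.ext fun s t => ?_
    exact congrArg Subtype.val (hk.star_eq t s)
  have hpos : κ.PosSemidef := by
    have h0 := (RKHS.posSemidef_tfae (K := κ)).out 0 2
    refine h0.2 ⟨hherm, fun f => ?_⟩
    have h1 := hk.form_nonneg f.support f
    have h2 : (f.sum fun x w => f.sum fun x' w' => ⟪κ x' x w, w'⟫_ℂ)
        = star (∑ s ∈ f.support, ∑ t ∈ f.support, ⟪f s, (k s t : H →L[ℂ] H) (f t)⟫_ℂ) := by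
      change ∑ t ∈ f.support, ∑ s ∈ f.support, ⟪(k s t : H →L[ℂ] H) (f t), f s⟫_ℂ = _
      rw [Finset.sum_comm, star_sum]
      refine Finset.sum_congr rfl fun s _ => ?_
      rw [star_sum]
      refine Finset.sum_congr rfl fun t _ => ?_
      exact (inner_conj_symm _ _).symm
    rw [h2]
    change 0 ≤ (star _ : ℂ).re
    rw [Complex.star_def, Complex.conj_re]
    exact (Complex.le_def.1 h1).1
  have : Fact κ.PosSemidef := ⟨hpos⟩
  refine ⟨RKHS.OfKernel κ, inferInstance, inferInstance, inferInstance,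
    fun s => RKHS.kerFun (RKHS.OfKernel κ) s, ?_, fun s t => ?_⟩
  · have := RKHS.kerFun_dense (𝕜 := ℂ) (RKHS.OfKernel κ)
    exact this
  · rw [← RKHS.kernel_apply, RKHS.OfKernel.kernel_ofKernel]

end Kernel

/-! ### Suprema of bounded increasing nets in a von Neumann algebra -/

section Positive

open scoped InnerProductSpace

variable {H : Type*} [NormedAddCommGroup H] [InnerProductSpace ℂ H] [CompleteSpace H]

theorem ContinuousLinearMap.re_inner_nonneg_of_nonneg {T : H →L[ℂ] H} (hT : 0 ≤ T) (h : H) :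
    0 ≤ (⟪h, T h⟫_ℂ).re :=
  ((ContinuousLinearMap.nonneg_iff_isPositive T).1 hT).re_inner_nonneg_right h

theorem ContinuousLinearMap.re_inner_le_of_le {T T' : H →L[ℂ] H} (hT : T ≤ T') (h : H) :
    (⟪h, T h⟫_ℂ).re ≤ (⟪h, T' h⟫_ℂ).re := by
  have h1 := re_inner_nonneg_of_nonneg (sub_nonneg.2 hT) h
  rw [sub_apply, inner_sub_right, Complex.sub_re] at h1
  linarith

theorem ContinuousLinearMap.nonneg_of_re_inner_nonneg {T : H →L[ℂ] H} (hsa : IsSelfAdjoint T)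
    (h : ∀ h, 0 ≤ (⟪h, T h⟫_ℂ).re) : 0 ≤ T := by
  rw [nonneg_iff_isPositive, isPositive_def']
  refine ⟨hsa, fun x => ?_⟩
  rw [reApplyInnerSelf_apply, inner_re_symm]
  exact h x

theorem ContinuousLinearMap.norm_apply_sq_le_of_nonneg {T : H →L[ℂ] H} (hT : 0 ≤ T) (h : H) :
    ‖T h‖ ^ 2 ≤ ‖T‖ * (⟪h, T h⟫_ℂ).re := by
  obtain ⟨c, rfl⟩ := CStarAlgebra.nonneg_iff_eq_star_mul_self.1 hT
  have h1 : (⟪h, (star c * c) h⟫_ℂ).re = ‖c h‖ ^ 2 := by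
    have h2 : ⟪h, (star c * c) h⟫_ℂ = ⟪c h, c h⟫_ℂ := adjoint_inner_right c h (c h)
    rw [h2, inner_self_eq_norm_sq_to_K, RCLike.ofReal_eq_complex_ofReal, ← Complex.ofReal_pow,
      Complex.ofReal_re]
  rw [h1, CStarRing.norm_star_mul_self]
  have h3 : ‖(star c * c) h‖ ≤ ‖c‖ * ‖c h‖ := by
    refine ((star c).le_opNorm (c h)).trans ?_
    rw [norm_star]
  calc ‖(star c * c) h‖ ^ 2 ≤ (‖c‖ * ‖c h‖) ^ 2 := by gcongr
    _ = _ := by ring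

theorem ContinuousLinearMap.re_inner_add_le {T : H →L[ℂ] H} (hT : 0 ≤ T) (h k : H) :
    (⟪h + k, T (h + k)⟫_ℂ).re ≤ 2 * (⟪h, T h⟫_ℂ).re + 2 * (⟪k, T k⟫_ℂ).re := by
  have h1 := re_inner_nonneg_of_nonneg hT (h - k)
  simp only [map_sub, map_add, inner_sub_left, inner_sub_right, inner_add_left, inner_add_right,
    Complex.sub_re, Complex.add_re] at h1 ⊢
  linarith

theorem ContinuousLinearMap.re_inner_le_norm (T : H →L[ℂ] H) (h : H) :
    (⟪h, T h⟫_ℂ).re ≤ ‖T‖ * ‖h‖ ^ 2 := by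
  calc (⟪h, T h⟫_ℂ).re ≤ ‖h‖ * ‖T h‖ := (Complex.re_le_norm _).trans (norm_inner_le_norm _ _)
    _ ≤ ‖h‖ * (‖T‖ * ‖h‖) := by gcongr; exact T.le_opNorm h
    _ = _ := by ring

end Positive

namespace VonNeumannAlgebra

open scoped InnerProductSpace

variable {H : Type u} [NormedAddCommGroup H] [InnerProductSpace ℂ H] [CompleteSpace H]
  {A : VonNeumannAlgebra H}

/-- Vigier's theorem: an increasing net in `A` with supremum `a` converges to `a`, in the sense of
quadratic forms. The differences `a - x` decrease strongly to a positive element `T` of `A`, and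
`a - T` is an upper bound of the net. -/
theorem exists_re_inner_lt_of_isLUB {d : Set A} (hne : d.Nonempty) (hd : DirectedOn (· ≤ ·) d)
    {a : A} (ha : IsLUB d a) (h : H) {ε : ℝ} (hε : 0 < ε) :
    ∃ x ∈ d, (⟪h, ((a - x : A) : H →L[ℂ] H) h⟫_ℂ).re < ε := by
  have : Nonempty d := hne.to_subtype
  have : IsDirectedOrder d := directedOn_iff_isDirectedOrder.1 hd
  set b : d → H →L[ℂ] H := fun x => ((a - x : A) : H →L[ℂ] H) with hb
  have hb0 : ∀ x, 0 ≤ b x := fun x => sub_nonneg.2 (ha.1 x.2 : (x : A) ≤ a)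
  have hbanti : ∀ {x y : d}, x ≤ y → b y ≤ b x := fun {x y} hxy =>
    sub_le_sub_left (show ((x : A) : H →L[ℂ] H) ≤ ((y : A) : H →L[ℂ] H) from hxy) _
  obtain ⟨x0⟩ : Nonempty d := inferInstance
  have hconv : ∀ k, ∃ l, Tendsto (fun x => b x k) atTop (𝓝 l) := by
    intro k
    have hanti : Antitone fun x => (⟪k, b x k⟫_ℂ).re := fun x y hxy =>
      ContinuousLinearMap.re_inner_le_of_le (hbanti hxy) k
    have hbdd : BddBelow (Set.range fun x => (⟪k, b x k⟫_ℂ).re) :=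
      ⟨0, by rintro _ ⟨x, rfl⟩; exact ContinuousLinearMap.re_inner_nonneg_of_nonneg (hb0 x) k⟩
    have hlim := tendsto_atTop_ciInf hanti hbdd
    refine CompleteSpace.complete (f := map (fun x => b x k) atTop) ?_
    rw [Metric.cauchy_iff]
    refine ⟨inferInstance, fun δ hδ => ?_⟩
    set C := ‖b x0‖ + 1 with hC
    have hC0 : 0 < C := by positivity
    obtain ⟨x1, hx1, hx01⟩ := ((hlim.eventually (gt_mem_nhds
      (lt_add_of_pos_right _ (show 0 < (δ / 2) ^ 2 / C by positivity)))).and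
      (eventually_ge_atTop x0)).exists
    have hclose : ∀ x, x1 ≤ x → dist (b x k) (b x1 k) < δ / 2 := by
      intro x hx
      have hnn : 0 ≤ b x1 - b x := sub_nonneg.2 (hbanti hx)
      have hle : b x1 - b x ≤ b x0 := (sub_le_self _ (hb0 x)).trans (hbanti hx01)
      have hnorm : ‖b x1 - b x‖ ≤ ‖b x0‖ := CStarAlgebra.norm_le_norm_of_nonneg_of_le hnn hle
      have h1 := ContinuousLinearMap.norm_apply_sq_le_of_nonneg hnn k
      have h2 : (⟪k, (b x1 - b x) k⟫_ℂ).re < (δ / 2) ^ 2 / C := by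
        rw [sub_apply, inner_sub_right, Complex.sub_re]
        have := ciInf_le hbdd x
        linarith
      have h3 := ContinuousLinearMap.re_inner_nonneg_of_nonneg hnn k
      rw [dist_comm, dist_eq_norm]
      refine lt_of_pow_lt_pow_left₀ 2 (by positivity) ?_
      calc ‖b x1 k - b x k‖ ^ 2 ≤ ‖b x1 - b x‖ * (⟪k, (b x1 - b x) k⟫_ℂ).re := h1
        _ ≤ C * (⟪k, (b x1 - b x) k⟫_ℂ).re := by gcongr; linarith
        _ < C * ((δ / 2) ^ 2 / C) := by gcongr
        _ = (δ / 2) ^ 2 := by field_simp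
    refine ⟨(fun x => b x k) '' Set.Ici x1, image_mem_map (mem_atTop x1), ?_⟩
    rintro _ ⟨x, hx, rfl⟩ _ ⟨y, hy, rfl⟩
    calc dist (b x k) (b y k) ≤ dist (b x k) (b x1 k) + dist (b y k) (b x1 k) :=
          dist_triangle_right _ _ _
      _ < δ / 2 + δ / 2 := add_lt_add (hclose x hx) (hclose y hy)
      _ = δ := add_halves δ
  choose f hf using hconv
  set Tl : H →ₗ[ℂ] H := linearMapOfTendsto f (fun x => (b x : H →ₗ[ℂ] H))
    (tendsto_pi_nhds.2 hf) with hTl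
  set T : H →L[ℂ] H := Tl.mkContinuous ‖b x0‖ (fun k => by
    refine le_of_tendsto (hf k).norm ?_
    filter_upwards [eventually_ge_atTop x0] with x hx
    refine ((b x).le_opNorm k).trans ?_
    gcongr
    exact CStarAlgebra.norm_le_norm_of_nonneg_of_le (hb0 x) (hbanti hx)) with hT
  have hlim : ∀ k, Tendsto (fun x => b x k) atTop (𝓝 (T k)) := hf
  have hlim2 : ∀ k, Tendsto (fun x => (⟪k, b x k⟫_ℂ).re) atTop (𝓝 (⟪k, T k⟫_ℂ).re) := fun k =>
    (Complex.continuous_re.tendsto _).comp (tendsto_const_nhds.inner (hlim k))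
  have hTA : T ∈ A := mem_of_tendsto b (fun x => (a - x : A).2) hlim
  have hTsa : IsSelfAdjoint T := by
    rw [ContinuousLinearMap.isSelfAdjoint_iff_isSymmetric]
    intro k l
    refine tendsto_nhds_unique ((hlim k).inner tendsto_const_nhds) ?_
    refine (tendsto_const_nhds.inner (hlim l)).congr fun x => ?_
    exact (((ContinuousLinearMap.nonneg_iff_isPositive _).1 (hb0 x)).isSymmetric k l).symm
  have hT0 : 0 ≤ T := ContinuousLinearMap.nonneg_of_re_inner_nonneg hTsa fun k =>
    ge_of_tendsto' (hlim2 k) fun x => ContinuousLinearMap.re_inner_nonneg_of_nonneg (hb0 x) k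
  have hub : a - ⟨T, hTA⟩ ∈ upperBounds d := by
    intro x hx
    have h1 : T ≤ b ⟨x, hx⟩ := by
      rw [← sub_nonneg]
      refine ContinuousLinearMap.nonneg_of_re_inner_nonneg
        ((hb0 ⟨x, hx⟩).isSelfAdjoint.sub hTsa) fun k => ?_
      rw [sub_apply, inner_sub_right, Complex.sub_re, sub_nonneg]
      refine le_of_tendsto (hlim2 k) ?_
      filter_upwards [eventually_ge_atTop (⟨x, hx⟩ : d)] with y hy
      exact ContinuousLinearMap.re_inner_le_of_le (hbanti hy) k
    have h2 : (⟨T, hTA⟩ : A) ≤ a - x := h1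
    exact le_sub_comm.1 h2
  have hTz : T = 0 := by
    have h1 : (⟨T, hTA⟩ : A) ≤ 0 := by
      have := ha.2 hub
      rwa [le_sub_self_iff] at this
    exact le_antisymm h1 hT0
  have h1 := hlim2 h
  rw [hTz] at h1
  obtain ⟨x, hx⟩ := (h1.eventually_lt_const (u := ε) (by simpa using hε)).exists
  exact ⟨x, x.2, hx⟩

/-- An upper bound of an increasing net is its supremum if the net converges to it, in the sense of
quadratic forms, on a total set of vectors. -/
theorem isLUB_of_forall_exists_re_inner_lt {d : Set A} (hne : d.Nonempty)
    (hd : DirectedOn (· ≤ ·) d) {a : A} (ha : a ∈ upperBounds d) {V : Set H}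
    (hV : (Submodule.span ℂ V).topologicalClosure = ⊤)
    (h : ∀ v ∈ V, ∀ ε : ℝ, 0 < ε → ∃ x ∈ d, (⟪v, ((a - x : A) : H →L[ℂ] H) v⟫_ℂ).re < ε) :
    IsLUB d a := by
  have hb0 : ∀ x ∈ d, (0 : H →L[ℂ] H) ≤ ((a - x : A) : H →L[ℂ] H) := fun x hx =>
    sub_nonneg.2 (show (x : H →L[ℂ] H) ≤ a from ha hx)
  have hanti : ∀ {x y : A}, x ≤ y → ((a - y : A) : H →L[ℂ] H) ≤ ((a - x : A) : H →L[ℂ] H) :=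
    fun {x y} hxy => sub_le_sub_left (show (x : H →L[ℂ] H) ≤ (y : H →L[ℂ] H) from hxy) _
  have hspan : ∀ v ∈ Submodule.span ℂ V, ∀ ε : ℝ, 0 < ε →
      ∃ x ∈ d, (⟪v, ((a - x : A) : H →L[ℂ] H) v⟫_ℂ).re < ε := by
    intro v hv
    induction hv using Submodule.span_induction with
    | mem v hv => exact h v hv
    | zero =>
      intro ε hε
      obtain ⟨x, hx⟩ := hne
      exact ⟨x, hx, by simpa using hε⟩
    | add v w _ _ hv hw =>
      intro ε hε
      obtain ⟨x, hx, hxv⟩ := hv (ε / 4) (by positivity)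
      obtain ⟨y, hy, hyw⟩ := hw (ε / 4) (by positivity)
      obtain ⟨z, hz, hxz, hyz⟩ := hd x hx y hy
      refine ⟨z, hz, (ContinuousLinearMap.re_inner_add_le (hb0 z hz) v w).trans_lt ?_⟩
      have h1 := ContinuousLinearMap.re_inner_le_of_le (hanti hxz) v
      have h2 := ContinuousLinearMap.re_inner_le_of_le (hanti hyz) w
      linarith
    | smul c v _ hv =>
      intro ε hε
      obtain ⟨x, hx, hxv⟩ := hv (ε / (‖c‖ ^ 2 + 1)) (by positivity)
      refine ⟨x, hx, ?_⟩
      have h1 : (⟪c • v, ((a - x : A) : H →L[ℂ] H) (c • v)⟫_ℂ).re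
          = ‖c‖ ^ 2 * (⟪v, ((a - x : A) : H →L[ℂ] H) v⟫_ℂ).re := by
        rw [map_smul, inner_smul_left, inner_smul_right, ← mul_assoc, Complex.conj_mul',
          ← Complex.ofReal_pow, Complex.re_ofReal_mul]
      have h0 := ContinuousLinearMap.re_inner_nonneg_of_nonneg (hb0 x hx) v
      rw [h1]
      calc _ ≤ (‖c‖ ^ 2 + 1) * (⟪v, ((a - x : A) : H →L[ℂ] H) v⟫_ℂ).re := by
            gcongr; linarith
        _ < (‖c‖ ^ 2 + 1) * (ε / (‖c‖ ^ 2 + 1)) := by gcongr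
        _ = ε := by field_simp
  have hall : ∀ v, ∀ ε : ℝ, 0 < ε → ∃ x ∈ d, (⟪v, ((a - x : A) : H →L[ℂ] H) v⟫_ℂ).re < ε := by
    intro v ε hε
    obtain ⟨x0, hx0⟩ := hne
    set C := ‖((a - x0 : A) : H →L[ℂ] H)‖ with hC
    have hC0 : 0 ≤ C := norm_nonneg _
    have hv : v ∈ closure (Submodule.span ℂ V : Set H) := by
      rw [← Submodule.topologicalClosure_coe, hV]
      trivial
    set δ := min 1 (ε / (4 * (C + 1))) with hδ
    have hδ0 : 0 < δ := by positivity
    obtain ⟨w, hw, hvw⟩ := Metric.mem_closure_iff.1 hv δ hδ0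
    obtain ⟨x, hx, hxw⟩ := hspan w hw (ε / 4) (by positivity)
    obtain ⟨z, hz, hxz, hx0z⟩ := hd x hx x0 hx0
    refine ⟨z, hz, ?_⟩
    have h1 := ContinuousLinearMap.re_inner_add_le (hb0 z hz) w (v - w)
    rw [add_sub_cancel] at h1
    have h2 := ContinuousLinearMap.re_inner_le_of_le (hanti hxz) w
    have h3 := (ContinuousLinearMap.re_inner_le_of_le (hanti hx0z) (v - w)).trans
      (ContinuousLinearMap.re_inner_le_norm _ _)
    have h4 : C * ‖v - w‖ ^ 2 ≤ ε / 4 := by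
      rw [dist_eq_norm] at hvw
      have h5 : ‖v - w‖ ^ 2 ≤ δ * 1 := by
        rw [sq]
        exact mul_le_mul hvw.le (hvw.le.trans (min_le_left _ _)) (norm_nonneg _) hδ0.le
      calc C * ‖v - w‖ ^ 2 ≤ (C + 1) * (ε / (4 * (C + 1))) := by
            refine mul_le_mul (by linarith) ?_ (by positivity) (by positivity)
            rw [mul_one] at h5
            exact h5.trans (min_le_right _ _)
        _ = ε / 4 := by field_simp
    linarith
  refine ⟨ha, fun u hu => ?_⟩
  change (a : H →L[ℂ] H) ≤ (u : H →L[ℂ] H)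
  rw [← sub_nonneg]
  have hdec : ∀ x ∈ d, (u - a : H →L[ℂ] H)
      = ((u : H →L[ℂ] H) - (x : H →L[ℂ] H)) - ((a - x : A) : H →L[ℂ] H) := fun x _ => by
    change (u - a : H →L[ℂ] H) = (u - x : H →L[ℂ] H) - (a - x : H →L[ℂ] H)
    abel
  have hux : ∀ x ∈ d, (0 : H →L[ℂ] H) ≤ (u : H →L[ℂ] H) - (x : H →L[ℂ] H) := fun x hx =>
    sub_nonneg.2 (show (x : H →L[ℂ] H) ≤ u from hu hx)
  refine ContinuousLinearMap.nonneg_of_re_inner_nonneg ?_ fun v => ?_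
  · obtain ⟨x, hx⟩ := hne
    rw [hdec x hx]
    exact (hux x hx).isSelfAdjoint.sub (hb0 x hx).isSelfAdjoint
  · refine le_of_forall_pos_lt_add fun ε hε => ?_
    obtain ⟨x, hx, hxv⟩ := hall v ε hε
    have h1 := ContinuousLinearMap.re_inner_nonneg_of_nonneg (hux x hx) v
    rw [hdec x hx, sub_apply, inner_sub_right, Complex.sub_re]
    linarith

/-- A normal map carries increasing nets that converge, in the sense of quadratic forms, to such
nets. -/
theorem exists_re_inner_map_lt {τ : A → A} (hτ : ScottContinuous τ) {ι : Type*} [Nonempty ι]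
    [Preorder ι] [IsDirectedOrder ι] {f : ι → A} (hf : Monotone f) {a : A} (ha : ∀ i, f i ≤ a)
    (hlim : ∀ v : H, ∀ ε : ℝ, 0 < ε → ∃ i, (⟪v, ((a - f i : A) : H →L[ℂ] H) v⟫_ℂ).re < ε) (v : H)
    {ε : ℝ} (hε : 0 < ε) : ∃ i, (⟪v, ((τ a - τ (f i) : A) : H →L[ℂ] H) v⟫_ℂ).re < ε := by
  have hne : (Set.range f).Nonempty := Set.range_nonempty f
  have hdir : DirectedOn (· ≤ ·) (Set.range f) := hf.directed_le.directedOn_range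
  have hlub : IsLUB (Set.range f) a := by
    refine isLUB_of_forall_exists_re_inner_lt hne hdir ?_ (V := Set.univ) ?_ fun v _ ε hε => ?_
    · rintro _ ⟨i, rfl⟩
      exact ha i
    · rw [Submodule.span_univ]
      exact top_le_iff.1 (Submodule.le_topologicalClosure _)
    · obtain ⟨i, hi⟩ := hlim v ε hε
      exact ⟨f i, ⟨i, rfl⟩, hi⟩
  have hmono : Monotone τ := hτ.monotone
  have hdir' : DirectedOn (· ≤ ·) (τ '' Set.range f) := by
    rw [← Set.range_comp]
    exact (hmono.comp hf).directed_le.directedOn_range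
  obtain ⟨_, ⟨_, ⟨i, rfl⟩, rfl⟩, hi⟩ := exists_re_inner_lt_of_isLUB (hne.image τ) hdir'
    (hτ hne hdir hlub) v hε
  exact ⟨i, hi⟩

end VonNeumannAlgebra

/-! ### Positive kernels and completely positive maps -/

section Kernels

variable {S : Type u} {H : Type u} [NormedAddCommGroup H] [InnerProductSpace ℂ H]
  [CompleteSpace H] {A : VonNeumannAlgebra H}

/-- Conjugation of a positive matrix by the diagonal matrix with entries `xᵢ`. -/
theorem CStarMatrix.nonneg_conj {R : Type*} [CStarAlgebra R] [PartialOrder R] [StarOrderedRing R]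
    {n : Type*} [Fintype n] {M : CStarMatrix n n R} (hM : 0 ≤ M) (x : n → R) :
    0 ≤ CStarMatrix.ofMatrix (Matrix.of fun i j => star (x i) * M i j * x j) := by
  obtain ⟨C, rfl⟩ : ∃ C : CStarMatrix n n R, M = star C * C :=
    CStarAlgebra.exists_eq_star_mul_self hM
  set C' : CStarMatrix n n R := CStarMatrix.ofMatrix (Matrix.of fun k j => C k j * x j) with hC'
  have h1 : CStarMatrix.ofMatrix (Matrix.of fun i j => star (x i) * (star C * C) i j * x j)
      = star C' * C' := by
    refine CStarMatrix.ext fun i j => ?_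
    change star (x i) * (star C * C) i j * x j = (star C' * C') i j
    rw [CStarMatrix.mul_apply, CStarMatrix.mul_apply, Finset.mul_sum, Finset.sum_mul]
    refine Finset.sum_congr rfl fun k _ => ?_
    change star (x i) * (star (C k i) * C k j) * x j = star (C k i * x i) * (C k j * x j)
    rw [star_mul]
    noncomm_ring
  rw [h1]
  exact star_mul_self_nonneg C'

theorem IsPosKernel.of_gram {K : Type*} [NormedAddCommGroup K] [InnerProductSpace ℂ K]
    [CompleteSpace K] (v : S → H →L[ℂ] K) (k : S → S → A)
    (hk : ∀ s t, (k s t : H →L[ℂ] H) = (v s).adjoint ∘L v t) : IsPosKernel k := fun _ s =>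
  CStarMatrix.gram_nonneg A.subtype Subtype.val_injective (fun i => v (s i)) _ fun i j =>
    hk (s i) (s j)

theorem IsPosKernel.map {k : S → S → A} (hk : IsPosKernel k) (τ : A →CP A) :
    IsPosKernel fun s t => τ (k s t) := fun _ s =>
  τ.map_cstarMatrix_nonneg _ (hk _ s)

end Kernels

section WordKernel

variable {H : Type u} [NormedAddCommGroup H] [InnerProductSpace ℂ H]
  [CompleteSpace H] {A : VonNeumannAlgebra H} (τ : A →CP A)

/-- The kernel `⟨x₁, …, xₘ | y₁, …, yₙ⟩ = τ(x₁⋆ τ(x₂⋆ ⋯ y₂) y₁)`, the shorter of the two lists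
being extended by units, which the words `θᵐ(xₘ) ⋯ θ(x₁) h` have to satisfy. -/
noncomputable def wordKernel : List A → List A → A
  | [], [] => 1
  | [], y :: t => τ (wordKernel [] t * y)
  | x :: s, [] => τ (star x * wordKernel s [])
  | x :: s, y :: t => τ (star x * wordKernel s t * y)
termination_by s t => s.length + t.length

variable {τ}

theorem wordKernel_eq (hunital : τ 1 = 1) (s t : List A) :
    wordKernel τ s t
      = τ (star (s.headD 1) * wordKernel τ s.tail t.tail * t.headD 1) := by
  cases s <;> cases t <;> simp [wordKernel, hunital]

/-- Stripping the first letter off each list conjugates the matrix by a diagonal matrix and removes one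
application of `τ`; both preserve positivity. -/
theorem wordKernel_nonneg (hunital : τ 1 = 1) (m : ℕ) {n : ℕ} (s : Fin n → List A)
    (hs : ∀ i, (s i).length ≤ m) :
    0 ≤ CStarMatrix.ofMatrix (Matrix.of fun i j => wordKernel τ (s i) (s j)) := by
  induction m generalizing s with
  | zero =>
    refine CStarMatrix.gram_nonneg A.subtype Subtype.val_injective
      (fun _ => ContinuousLinearMap.id ℂ H) _ fun i j => ?_
    have h1 : ∀ i, s i = [] := fun i => List.length_eq_zero_iff.1 (Nat.le_zero.1 (hs i))
    change ((wordKernel τ (s i) (s j) : A) : H →L[ℂ] H) = _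
    rw [h1, h1, wordKernel, ContinuousLinearMap.comp_id]
    exact (star_one (H →L[ℂ] H)).symm
  | succ m ih =>
    have h1 := ih (fun i => (s i).tail) fun i => by
      rw [List.length_tail]
      have := hs i
      omega
    have h2 := τ.map_cstarMatrix_nonneg _ (CStarMatrix.nonneg_conj h1 fun i => (s i).headD 1)
    refine h2.trans (le_of_eq (CStarMatrix.ext fun i j => ?_))
    exact (wordKernel_eq hunital (s i) (s j)).symm

theorem isPosKernel_wordKernel (hunital : τ 1 = 1) : IsPosKernel (wordKernel τ) := fun _ s =>
  wordKernel_nonneg hunital (Finset.univ.sup fun i => (s i).length) s fun i =>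
    Finset.le_sup (f := fun i => (s i).length) (Finset.mem_univ i)

end WordKernel

/-! ### Induced representations of the commutant -/

/-- The element `d = (‖c‖² - c⋆c)^{1/2}`, which is a witness for the boundedness of operators built
from `c`. -/
theorem CStarAlgebra.exists_star_mul_self_add_star_mul_self {X : Type*} [CStarAlgebra X]
    [PartialOrder X] [StarOrderedRing X] (c : X) :
    ∃ d : X, star c * c + star d * d = ((‖c‖ ^ 2 : ℝ) : ℂ) • (1 : X) := by
  obtain ⟨d, hd⟩ := CStarAlgebra.exists_eq_star_mul_self
    (sub_nonneg.2 (CStarAlgebra.star_mul_le_algebraMap_norm_sq (a := c)))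
  refine ⟨d, ?_⟩
  rw [← hd, add_sub_cancel, Algebra.algebraMap_eq_smul_one, Complex.coe_smul]

namespace VonNeumannAlgebra

variable {K : Type*} [NormedAddCommGroup K] [InnerProductSpace ℂ K] [CompleteSpace K]

/-- The commutant of a set of operators and of their adjoints. -/
noncomputable def commutantOf (X : Set (K →L[ℂ] K)) : VonNeumannAlgebra K where
  toStarSubalgebra := StarSubalgebra.centralizer ℂ X
  centralizer_centralizer' := by simp

theorem mem_commutantOf_iff {X : Set (K →L[ℂ] K)} (hX : ∀ T ∈ X, star T ∈ X) {b : K →L[ℂ] K} :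
    b ∈ commutantOf X ↔ ∀ T ∈ X, T * b = b * T := by
  change b ∈ StarSubalgebra.centralizer ℂ X ↔ _
  rw [StarSubalgebra.mem_centralizer_iff]
  exact ⟨fun h T hT => (h T hT).1, fun h T hT => ⟨h T hT, h _ (hX T hT)⟩⟩

end VonNeumannAlgebra

section Induced

open ContinuousLinearMap

variable {S : Type*} {H : Type u} [NormedAddCommGroup H] [InnerProductSpace ℂ H]
  [CompleteSpace H] {K : Type u} [NormedAddCommGroup K] [InnerProductSpace ℂ K] [CompleteSpace K]
  (A : VonNeumannAlgebra H) (W : S → H →L[ℂ] K)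

/-- The operator `T` on `K` extends `W(s)h ↦ W(s)ch`. -/
def IsInducedBy (c : H →L[ℂ] H) (T : K →L[ℂ] K) : Prop := ∀ s, T ∘L W s = W s ∘L c

/-- The operators on `K` induced by the commutant of `A`. -/
def inducedCommutant : Set (K →L[ℂ] K) := {T | ∃ c ∈ A.commutant, IsInducedBy W c T}

/-- The commutant of the operators on `K` induced by the commutant of `A`. -/
noncomputable def inducedAlgebra : VonNeumannAlgebra K :=
  VonNeumannAlgebra.commutantOf (inducedCommutant A W)

/-- The operators `H → K` that intertwine the actions of the commutant of `A`. -/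
def intertwiners : Submodule ℂ (H →L[ℂ] K) where
  carrier := {w | ∀ c ∈ A.commutant, ∀ T, IsInducedBy W c T → T ∘L w = w ∘L c}
  add_mem' {w w'} hw hw' c hc T hT := by
    rw [comp_add, add_comp, hw c hc T hT, hw' c hc T hT]
  zero_mem' c hc T hT := by rw [comp_zero, zero_comp]
  smul_mem' r w hw c hc T hT := by rw [comp_smul, smul_comp, hw c hc T hT]

variable {A W}

theorem comp_comm_of_mem {a c : H →L[ℂ] H} (ha : a ∈ A) (hc : c ∈ A.commutant) :
    a ∘L c = c ∘L a := VonNeumannAlgebra.mem_commutant_iff.1 hc a ha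

theorem adjoint_mem_commutant {c : H →L[ℂ] H} (hc : c ∈ A.commutant) :
    c.adjoint ∈ A.commutant := star_mem (S := VonNeumannAlgebra H) hc

/-- The commutant of `A` acts on `K`, because its elements commute with the kernel `W(s)⋆W(t)`. -/
theorem exists_isInducedBy (hW : IsTotalFamily W) (hk : ∀ s t, (W s).adjoint ∘L W t ∈ A)
    {c : H →L[ℂ] H} (hc : c ∈ A.commutant) : ∃ T, IsInducedBy W c T := by
  obtain ⟨d, hd⟩ := CStarAlgebra.exists_star_mul_self_add_star_mul_self (⟨c, hc⟩ : A.commutant)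
  have hd' : c.adjoint ∘L c + (d : H →L[ℂ] H).adjoint ∘L (d : H →L[ℂ] H)
      = ((‖c‖ ^ 2 : ℝ) : ℂ) • ContinuousLinearMap.id ℂ H := congrArg Subtype.val hd
  have key : ∀ (e : H →L[ℂ] H), e ∈ A.commutant → ∀ s t,
      (W s ∘L e).adjoint ∘L (W t ∘L e) = ((W s).adjoint ∘L W t) ∘L (e.adjoint ∘L e) := by
    intro e he s t
    rw [adjoint_comp]
    calc (e.adjoint ∘L (W s).adjoint) ∘L (W t ∘L e)
        = (e.adjoint ∘L ((W s).adjoint ∘L W t)) ∘L e := rfl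
      _ = _ := by
        rw [← comp_comm_of_mem (hk s t) (adjoint_mem_commutant he)]
        rfl
  refine hW.exists_extension (fun s => W s ∘L c) (fun s => W s ∘L (d : H →L[ℂ] H)) ‖c‖
    (norm_nonneg _) fun s t => ?_
  rw [key c hc, key d d.2, ← comp_add, hd', comp_smul, comp_id]

theorem IsInducedBy.adjoint (hW : IsTotalFamily W) (hk : ∀ s t, (W s).adjoint ∘L W t ∈ A)
    {c : H →L[ℂ] H} (hc : c ∈ A.commutant) {T : K →L[ℂ] K} (hT : IsInducedBy W c T) :
    IsInducedBy W c.adjoint T.adjoint := by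
  refine fun s => hW.ext_left fun t => ?_
  calc (W t).adjoint ∘L T.adjoint ∘L W s = (T ∘L W t).adjoint ∘L W s := by
        rw [adjoint_comp]; rfl
    _ = c.adjoint ∘L ((W t).adjoint ∘L W s) := by rw [hT t, adjoint_comp]; rfl
    _ = _ := by
        rw [← comp_comm_of_mem (hk t s) (adjoint_mem_commutant hc)]
        rfl

theorem mem_inducedAlgebra_iff (hW : IsTotalFamily W) (hk : ∀ s t, (W s).adjoint ∘L W t ∈ A)
    {b : K →L[ℂ] K} : b ∈ inducedAlgebra A W ↔
      ∀ c ∈ A.commutant, ∀ T, IsInducedBy W c T → T ∘L b = b ∘L T := by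
  rw [inducedAlgebra, VonNeumannAlgebra.mem_commutantOf_iff]
  · exact ⟨fun h c hc T hT => h T ⟨c, hc, hT⟩, fun h T ⟨c, hc, hT⟩ => h c hc T hT⟩
  · rintro T ⟨c, hc, hT⟩
    exact ⟨c.adjoint, adjoint_mem_commutant hc, hT.adjoint hW hk hc⟩

theorem family_mem_intertwiners (s : S) : W s ∈ intertwiners A W := fun _ _ _ hT => hT s

theorem comp_mem_intertwiners {w : H →L[ℂ] K} (hw : w ∈ intertwiners A W) {a : H →L[ℂ] H}
    (ha : a ∈ A) : w ∘L a ∈ intertwiners A W := by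
  intro c hc T hT
  calc T ∘L w ∘L a = (T ∘L w) ∘L a := rfl
    _ = w ∘L (c ∘L a) := by rw [hw c hc T hT]; rfl
    _ = _ := by rw [← comp_comm_of_mem ha hc]; rfl

theorem comp_mem_intertwiners' (hW : IsTotalFamily W) (hk : ∀ s t, (W s).adjoint ∘L W t ∈ A)
    {b : K →L[ℂ] K} (hb : b ∈ inducedAlgebra A W) {w : H →L[ℂ] K} (hw : w ∈ intertwiners A W) :
    b ∘L w ∈ intertwiners A W := by
  intro c hc T hT
  calc T ∘L b ∘L w = (T ∘L b) ∘L w := rfl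
    _ = b ∘L (T ∘L w) := by rw [(mem_inducedAlgebra_iff hW hk).1 hb c hc T hT]; rfl
    _ = _ := by rw [hw c hc T hT]; rfl

/-- The bicommutant theorem at work: `w⋆w'` commutes with the commutant of `A`. -/
theorem adjoint_comp_mem (hW : IsTotalFamily W) (hk : ∀ s t, (W s).adjoint ∘L W t ∈ A)
    {w w' : H →L[ℂ] K} (hw : w ∈ intertwiners A W) (hw' : w' ∈ intertwiners A W) :
    w.adjoint ∘L w' ∈ A := by
  refine VonNeumannAlgebra.mem_of_forall_commutant fun c hc => ?_
  obtain ⟨T, hT⟩ := exists_isInducedBy hW hk hc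
  have h1 := hw c.adjoint (adjoint_mem_commutant hc) T.adjoint (hT.adjoint hW hk hc)
  have h2 := congrArg ContinuousLinearMap.adjoint h1
  rw [adjoint_comp, adjoint_comp, adjoint_adjoint, adjoint_adjoint] at h2
  calc c ∘L (w.adjoint ∘L w') = (c ∘L w.adjoint) ∘L w' := rfl
    _ = w.adjoint ∘L (T ∘L w') := by rw [← h2]; rfl
    _ = _ := by rw [hw' c hc T hT]; rfl

theorem comp_adjoint_mem (hW : IsTotalFamily W) (hk : ∀ s t, (W s).adjoint ∘L W t ∈ A)
    {w w' : H →L[ℂ] K} (hw : w ∈ intertwiners A W) (hw' : w' ∈ intertwiners A W) :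
    w ∘L w'.adjoint ∈ inducedAlgebra A W := by
  refine (mem_inducedAlgebra_iff hW hk).2 fun c hc T hT => ?_
  have h1 := hw' c.adjoint (adjoint_mem_commutant hc) T.adjoint (hT.adjoint hW hk hc)
  have h2 := congrArg ContinuousLinearMap.adjoint h1
  rw [adjoint_comp, adjoint_comp, adjoint_adjoint, adjoint_adjoint] at h2
  calc T ∘L (w ∘L w'.adjoint) = (T ∘L w) ∘L w'.adjoint := rfl
    _ = w ∘L (c ∘L w'.adjoint) := by rw [hw c hc T hT]; rfl
    _ = _ := by rw [← h2]; rfl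

end Induced

/-! ### Resolvents of positive operators -/

section Resolvent

open scoped InnerProductSpace

variable {H K : Type*} [NormedAddCommGroup H] [InnerProductSpace ℂ H] [CompleteSpace H]
  [NormedAddCommGroup K] [InnerProductSpace ℂ K] [CompleteSpace K]

/-- The operator `(1 + G)⁻¹`. -/
noncomputable def oneAddInv (G : K →L[ℂ] K) : K →L[ℂ] K := Ring.inverse (1 + G)

theorem isUnit_one_add {G : K →L[ℂ] K} (hG : 0 ≤ G) : IsUnit (1 + G) :=
  CStarAlgebra.isUnit_of_le 1 (le_add_of_nonneg_right hG)

theorem one_add_mul_oneAddInv {G : K →L[ℂ] K} (hG : 0 ≤ G) : (1 + G) * oneAddInv G = 1 :=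
  Ring.mul_inverse_cancel _ (isUnit_one_add hG)

theorem oneAddInv_anti {G G' : K →L[ℂ] K} (hG : 0 ≤ G) (h : G ≤ G') :
    oneAddInv G' ≤ oneAddInv G := by
  obtain ⟨u, hu⟩ := isUnit_one_add hG
  obtain ⟨v, hv⟩ := isUnit_one_add (hG.trans h)
  rw [oneAddInv, oneAddInv, ← hu, ← hv, Ring.inverse_unit, Ring.inverse_unit]
  refine CStarAlgebra.inv_le_inv ?_ ?_
  · rw [hu]
    exact zero_le_one.trans (le_add_of_nonneg_right hG)
  · rw [hu, hv]
    exact add_le_add_right h 1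

theorem oneAddInv_nonneg {G : K →L[ℂ] K} (hG : 0 ≤ G) : 0 ≤ oneAddInv G := by
  obtain ⟨u, hu⟩ := isUnit_one_add hG
  rw [oneAddInv, ← hu, Ring.inverse_unit]
  refine CFC.inv_nonneg_of_nonneg u ?_
  rw [hu]
  exact zero_le_one.trans (le_add_of_nonneg_right hG)

theorem oneAddInv_mul_self_le {G : K →L[ℂ] K} (hG : 0 ≤ G) :
    oneAddInv G * oneAddInv G ≤ oneAddInv G := by
  have hsa : star (oneAddInv G) = oneAddInv G := (oneAddInv_nonneg hG).isSelfAdjoint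
  have h1 := star_left_conjugate_nonneg hG (oneAddInv G)
  have h2 : star (oneAddInv G) * G * oneAddInv G
      = oneAddInv G - oneAddInv G * oneAddInv G := by
    have h3 := one_add_mul_oneAddInv hG
    rw [add_mul, one_mul] at h3
    rw [hsa, mul_assoc, eq_sub_of_add_eq' h3, mul_sub, mul_one]
  rwa [h2, sub_nonneg] at h1

theorem oneAddInv_mem {B : VonNeumannAlgebra K} {G : K →L[ℂ] K} (hG : 0 ≤ G) (hGB : G ∈ B) :
    oneAddInv G ∈ B := by
  refine VonNeumannAlgebra.mem_of_forall_commutant fun c hc => ?_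
  obtain ⟨u, hu⟩ := isUnit_one_add hG
  rw [oneAddInv, ← hu, Ring.inverse_unit]
  have h1 : Commute c (u : K →L[ℂ] K) := by
    rw [hu]
    exact (Commute.one_right c).add_right (VonNeumannAlgebra.mem_commutant_iff.1 hc G hGB).symm
  exact h1.units_inv_right

/-- If `n w w⋆ ≤ G`, then `w⋆ (1 + G)⁻¹ w ≤ 1 / n`. -/
theorem re_inner_oneAddInv_le {G : K →L[ℂ] K} (hG : 0 ≤ G) {w : H →L[ℂ] K} {n : ℕ}
    (hn : n • (w ∘L w.adjoint) ≤ G) (h : H) :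
    n * (⟪w h, oneAddInv G (w h)⟫_ℂ).re ≤ ‖h‖ ^ 2 := by
  set x := oneAddInv G (w h) with hx
  have hGx : w h = x + G x :=
    (congrArg (fun T : K →L[ℂ] K => T (w h)) (one_add_mul_oneAddInv hG)).symm
  set q := (⟪w h, x⟫_ℂ).re with hq
  have h1 : (n : ℝ) * ‖w.adjoint x‖ ^ 2 ≤ q := by
    have h2 := ContinuousLinearMap.re_inner_le_of_le hn x
    have h3 : (⟪x, (n • (w ∘L w.adjoint)) x⟫_ℂ).re = n * ‖w.adjoint x‖ ^ 2 := by
      have h4 : ⟪x, (n • (w ∘L w.adjoint)) x⟫_ℂ = n * ⟪w.adjoint x, w.adjoint x⟫_ℂ := by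
        rw [ContinuousLinearMap.adjoint_inner_left, smul_apply, ← Nat.cast_smul_eq_nsmul ℂ,
          inner_smul_right]
        rfl
      rw [h4, inner_self_eq_norm_sq_to_K, RCLike.ofReal_eq_complex_ofReal, ← Complex.ofReal_pow,
        ← Complex.ofReal_natCast, Complex.re_ofReal_mul, Complex.ofReal_re]
    have h5 : q = ‖x‖ ^ 2 + (⟪x, G x⟫_ℂ).re := by
      rw [hq, ← Complex.conj_re, inner_conj_symm, hGx, inner_add_right, Complex.add_re,
        inner_self_eq_norm_sq_to_K, RCLike.ofReal_eq_complex_ofReal, ← Complex.ofReal_pow,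
        Complex.ofReal_re]
    rw [h3] at h2
    have := sq_nonneg ‖x‖
    linarith
  have h2 : q ≤ ‖h‖ * ‖w.adjoint x‖ := by
    rw [hq, ← ContinuousLinearMap.adjoint_inner_right]
    exact (Complex.re_le_norm _).trans (norm_inner_le_norm _ _)
  have hq0 : 0 ≤ q := le_trans (by positivity) h1
  rcases hq0.eq_or_lt with h0 | h0
  · rw [← h0, mul_zero]
    positivity
  · have h3 : q ^ 2 ≤ ‖h‖ ^ 2 * ‖w.adjoint x‖ ^ 2 := by
      rw [← mul_pow]
      gcongr
    have h4 : (n : ℝ) * q ^ 2 ≤ ‖h‖ ^ 2 * q := by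
      calc (n : ℝ) * q ^ 2 ≤ n * (‖h‖ ^ 2 * ‖w.adjoint x‖ ^ 2) := by gcongr
        _ = ‖h‖ ^ 2 * (n * ‖w.adjoint x‖ ^ 2) := by ring
        _ ≤ _ := by gcongr
    have h5 : (n * q) * q ≤ ‖h‖ ^ 2 * q := by nlinarith
    exact le_of_mul_le_mul_right h5 h0

end Resolvent

/-! ### The approximate unit generated by a total family -/

section ApproximateUnit

open ContinuousLinearMap
open scoped InnerProductSpace

variable {S : Type*} {H : Type u} [NormedAddCommGroup H] [InnerProductSpace ℂ H]
  [CompleteSpace H] {K : Type u} [NormedAddCommGroup K] [InnerProductSpace ℂ K] [CompleteSpace K]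
  {A : VonNeumannAlgebra H} {W : S → H →L[ℂ] K}

/-- The operator `∑ W(s) W(s)⋆`, summed over a finite multiset of indices. -/
noncomputable def frameOp (W : S → H →L[ℂ] K) (m : Multiset S) : K →L[ℂ] K :=
  (m.map fun s => W s ∘L (W s).adjoint).sum

theorem frameOp_cons (s : S) (m : Multiset S) :
    frameOp W (s ::ₘ m) = W s ∘L (W s).adjoint + frameOp W m := by
  simp [frameOp]

theorem frameOp_nonneg (m : Multiset S) : 0 ≤ frameOp W m := by
  induction m using Multiset.induction with
  | empty => exact le_rfl
  | cons s m ih =>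
    rw [frameOp_cons]
    refine add_nonneg ?_ ih
    rw [nonneg_iff_isPositive]
    have := isPositive_one (𝕜 := ℂ) (E := H) |>.conj_adjoint (W s)
    rwa [one_def, id_comp] at this

theorem frameOp_mono {m m' : Multiset S} (h : m ≤ m') : frameOp W m ≤ frameOp W m' := by
  obtain ⟨k, rfl⟩ := Multiset.le_iff_exists_add.1 h
  have h1 : frameOp W (m + k) = frameOp W m + frameOp W k := by simp [frameOp]
  rw [h1]
  exact le_add_of_nonneg_right (frameOp_nonneg k)

theorem frameOp_replicate (n : ℕ) (s : S) :
    frameOp W (Multiset.replicate n s) = n • (W s ∘L (W s).adjoint) := by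
  simp [frameOp]

theorem frameOp_mem (hW : IsTotalFamily W) (hk : ∀ s t, (W s).adjoint ∘L W t ∈ A)
    (m : Multiset S) : frameOp W m ∈ inducedAlgebra A W := by
  refine multiset_sum_mem _ fun b hb => ?_
  obtain ⟨s, -, rfl⟩ := Multiset.mem_map.1 hb
  exact comp_adjoint_mem hW hk (family_mem_intertwiners s) (family_mem_intertwiners s)

/-- The operators `G (1 + G)⁻¹ = 1 - (1 + G)⁻¹`, with `G = ∑ W(s) W(s)⋆`, increase to `1`. -/
theorem exists_re_inner_oneAddInv_lt (hW : IsTotalFamily W)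
    (hk : ∀ s t, (W s).adjoint ∘L W t ∈ A) (v : K) {ε : ℝ} (hε : 0 < ε) :
    ∃ m, (⟪v, oneAddInv (frameOp W m) v⟫_ℂ).re < ε := by
  set r : Multiset S → inducedAlgebra A W := fun m =>
    ⟨oneAddInv (frameOp W m), oneAddInv_mem (frameOp_nonneg m) (frameOp_mem hW hk m)⟩ with hr
  have hmono : Monotone fun m => 1 - r m := fun m m' h =>
    sub_le_sub_left (show r m' ≤ r m from oneAddInv_anti (frameOp_nonneg m) (frameOp_mono h)) 1
  have hdirected : IsDirectedOrder (Multiset S) :=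
    ⟨fun m m' => ⟨m + m', Multiset.le_add_right _ _, Multiset.le_add_left _ _⟩⟩
  have hne : (Set.range fun m => 1 - r m).Nonempty := Set.range_nonempty _
  have hdir : DirectedOn (· ≤ ·) (Set.range fun m => 1 - r m) :=
    hmono.directed_le.directedOn_range
  have hlub : IsLUB (Set.range fun m => 1 - r m) 1 := by
    refine VonNeumannAlgebra.isLUB_of_forall_exists_re_inner_lt hne hdir ?_ hW ?_
    · rintro _ ⟨m, rfl⟩
      exact sub_le_self _ (show 0 ≤ r m from oneAddInv_nonneg (frameOp_nonneg m))
    · rintro _ ⟨s, h, rfl⟩ ε hε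
      obtain ⟨n, hn⟩ := exists_nat_gt (‖h‖ ^ 2 / ε)
      have hn0 : (0 : ℝ) < n := lt_of_le_of_lt (by positivity) hn
      refine ⟨_, ⟨Multiset.replicate n s, rfl⟩, ?_⟩
      have h1 := re_inner_oneAddInv_le (frameOp_nonneg (W := W) (Multiset.replicate n s))
        (w := W s) (n := n) (frameOp_replicate n s).ge h
      have h2 : (((1 : inducedAlgebra A W) - (1 - r (Multiset.replicate n s)) :
          inducedAlgebra A W) : K →L[ℂ] K) = oneAddInv (frameOp W (Multiset.replicate n s)) := by
        rw [sub_sub_cancel]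
      rw [h2]
      rw [div_lt_iff₀ hε] at hn
      exact lt_of_mul_lt_mul_left (h1.trans_lt hn) hn0.le
  obtain ⟨_, ⟨m, rfl⟩, hm⟩ := VonNeumannAlgebra.exists_re_inner_lt_of_isLUB hne hdir hlub v hε
  refine ⟨m, ?_⟩
  have h2 : (((1 : inducedAlgebra A W) - (1 - r m) : inducedAlgebra A W) : K →L[ℂ] K)
      = oneAddInv (frameOp W m) := by rw [sub_sub_cancel]
  rwa [h2] at hm

end ApproximateUnit

/-! ### The words of a dilation -/

section InducedFamily

open ContinuousLinearMap
open scoped InnerProductSpace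

variable {H : Type u} [NormedAddCommGroup H] [InnerProductSpace ℂ H] [CompleteSpace H]
  {A : VonNeumannAlgebra H} {τ : A →CP A} {K : Type u} [NormedAddCommGroup K]
  [InnerProductSpace ℂ K] [CompleteSpace K]

theorem ContinuousLinearMap.adjoint_conj_mono {T T' : K →L[ℂ] K} (hT : T ≤ T') (w : H →L[ℂ] K) :
    w.adjoint ∘L T ∘L w ≤ w.adjoint ∘L T' ∘L w := by
  rw [ContinuousLinearMap.le_def] at hT ⊢
  have := hT.adjoint_conj w
  rwa [sub_comp, comp_sub] at this

set_option maxHeartbeats 1000000 in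
/-- Let `V` be a family indexed by the intertwiners with `V(w)⋆V(w') = τ(w⋆w')`. A contraction that
annihilates the operators `V(Gw)`, with `G` a finite sum of operators `W(s)W(s)⋆`, annihilates all
`V(w)`: with `r = (1 + G)⁻¹`, the operators `V(w)` and `V(rw)` differ by `V(Grw)`, and
`V(rw)⋆V(rw) = τ(w⋆r²w) ≤ τ(w⋆rw)` becomes small because `τ` is normal. -/
theorem comp_eq_zero_of_comp_frameOp_eq_zero {S : Type*} {W : S → H →L[ℂ] K}
    (hnormal : ScottContinuous τ) (hW : IsTotalFamily W) (hk : ∀ s t, (W s).adjoint ∘L W t ∈ A)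
    {L : Type*} [NormedAddCommGroup L] [InnerProductSpace ℂ L] [CompleteSpace L]
    (V : intertwiners A W → H →L[ℂ] L) (hVadd : ∀ w w', V (w + w') = V w + V w')
    (hVk : ∀ (w w' : intertwiners A W) (h : (w : H →L[ℂ] K).adjoint ∘L (w' : H →L[ℂ] K) ∈ A),
      (V w).adjoint ∘L V w' = (τ ⟨_, h⟩ : A))
    {P : L →L[ℂ] L} (hPnorm : ∀ x, ‖P x‖ ≤ ‖x‖)
    (hPframe : ∀ (m : Multiset S) (w : intertwiners A W)
      (h : frameOp W m ∘L (w : H →L[ℂ] K) ∈ intertwiners A W), P ∘L V ⟨_, h⟩ = 0)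
    (w : intertwiners A W) : P ∘L V w = 0 := by
  obtain ⟨κ, hκ⟩ : ∃ κ : intertwiners A W → intertwiners A W → A, ∀ w w',
      (κ w w' : H →L[ℂ] H) = (w : H →L[ℂ] K).adjoint ∘L (w' : H →L[ℂ] K) :=
    ⟨fun w w' => ⟨_, adjoint_comp_mem hW hk w.2 w'.2⟩, fun _ _ => rfl⟩
  obtain ⟨v, hv⟩ : ∃ v : Multiset S → intertwiners A W, ∀ m,
      (v m : H →L[ℂ] K) = oneAddInv (frameOp W m) ∘L (w : H →L[ℂ] K) :=
    ⟨fun m => ⟨_, comp_mem_intertwiners' hW hk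
      (oneAddInv_mem (frameOp_nonneg m) (frameOp_mem hW hk m)) w.2⟩, fun _ => rfl⟩
  have hVκ : ∀ w w', (V w).adjoint ∘L V w' = (τ (κ w w') : A) := fun w w' => by
    have h1 : κ w w' = ⟨_, adjoint_comp_mem hW hk w.2 w'.2⟩ := Subtype.ext (hκ w w')
    rw [h1]
    exact hVk w w' _
  have hdirected : IsDirectedOrder (Multiset S) :=
    ⟨fun m m' => ⟨m + m', Multiset.le_add_right _ _, Multiset.le_add_left _ _⟩⟩
  have hκv : ∀ m, (κ w (v m) : H →L[ℂ] H)
      = (w : H →L[ℂ] K).adjoint ∘L oneAddInv (frameOp W m) ∘L (w : H →L[ℂ] K) := fun m => by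
    rw [hκ, hv]
  obtain ⟨f, hf⟩ : ∃ f : Multiset S → A, ∀ m, f m = κ w w - κ w (v m) := ⟨_, fun _ => rfl⟩
  -- The increasing net `w⋆(1 - (1 + G)⁻¹)w`.
  have hsub : ∀ m, κ w w - f m = κ w (v m) := fun m => by rw [hf, sub_sub_cancel]
  have hmono : Monotone f := fun m m' h => by
    have h1 : κ w (v m') ≤ κ w (v m) := by
      change (κ w (v m') : H →L[ℂ] H) ≤ (κ w (v m) : H →L[ℂ] H)
      rw [hκv, hκv]
      exact adjoint_conj_mono (oneAddInv_anti (frameOp_nonneg m) (frameOp_mono h)) _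
    rw [hf, hf]
    exact sub_le_sub_left h1 _
  have hle : ∀ m, f m ≤ κ w w := fun m => by
    have h1 := adjoint_conj_mono (oneAddInv_nonneg (frameOp_nonneg (W := W) m)) (w : H →L[ℂ] K)
    rw [zero_comp, comp_zero, ← hκv] at h1
    rw [hf]
    exact sub_le_self _ h1
  have hlim : ∀ x : H, ∀ δ : ℝ, 0 < δ →
      ∃ m, (⟪x, ((κ w w - f m : A) : H →L[ℂ] H) x⟫_ℂ).re < δ := by
    intro x δ hδ
    obtain ⟨m, hm⟩ := exists_re_inner_oneAddInv_lt hW hk ((w : H →L[ℂ] K) x) hδ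
    refine ⟨m, ?_⟩
    rw [hsub, hκv, comp_apply, adjoint_inner_right]
    exact hm
  have hsq : ∀ m, κ (v m) (v m) ≤ κ w (v m) := fun m => by
    have h6 := adjoint_conj_mono (oneAddInv_mul_self_le (frameOp_nonneg (W := W) m))
      (w : H →L[ℂ] K)
    have h7 : (oneAddInv (frameOp W m)).adjoint = oneAddInv (frameOp W m) :=
      (oneAddInv_nonneg (frameOp_nonneg m)).isSelfAdjoint
    change (κ (v m) (v m) : H →L[ℂ] H) ≤ (κ w (v m) : H →L[ℂ] H)
    rw [hκv, hκ, hv, adjoint_comp, h7]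
    exact h6
  have hdecomp : ∀ m, ∃ h, w = v m + ⟨frameOp W m ∘L (v m : H →L[ℂ] K), h⟩ := fun m => by
    refine ⟨comp_mem_intertwiners' hW hk (frameOp_mem hW hk m) (v m).2, Subtype.ext ?_⟩
    have h3 : (1 + frameOp W m) * oneAddInv (frameOp W m) = 1 :=
      one_add_mul_oneAddInv (frameOp_nonneg m)
    rw [add_mul, one_mul] at h3
    have h4 := congrArg (fun T : K →L[ℂ] K => T ∘L (w : H →L[ℂ] K)) h3
    change (w : H →L[ℂ] K) = (v m : H →L[ℂ] K) + frameOp W m ∘L (v m : H →L[ℂ] K)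
    rw [hv]
    exact h4.symm
  ext h
  change P (V w h) = 0
  refine norm_le_zero_iff.1 (le_of_forall_pos_le_add fun ε hε => ?_)
  obtain ⟨m, hm⟩ := VonNeumannAlgebra.exists_re_inner_map_lt hnormal hmono hle hlim h
    (show 0 < ε ^ 2 by positivity)
  have h1 : τ (κ w w) - τ (f m) = τ (κ w (v m)) := by rw [← map_sub, hsub]
  rw [h1] at hm
  have h3 : P (V w h) = P (V (v m) h) := by
    obtain ⟨h', h2⟩ := hdecomp m
    have h4 := congrArg (fun T : H →L[ℂ] L => T h) (hPframe m (v m) h')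
    have h5 : P (V ⟨frameOp W m ∘L (v m : H →L[ℂ] K), h'⟩ h) = 0 := h4
    have h6 := congrArg (fun x => P (V x h)) h2
    rw [h6, hVadd, add_apply, map_add, h5, add_zero]
  have h4 : ‖V (v m) h‖ ^ 2 = (⟪h, (τ (κ (v m) (v m)) : H →L[ℂ] H) h⟫_ℂ).re := by
    rw [← hVκ, comp_apply, adjoint_inner_right, inner_self_eq_norm_sq_to_K,
      RCLike.ofReal_eq_complex_ofReal, ← Complex.ofReal_pow, Complex.ofReal_re]
  have h6 : ‖V (v m) h‖ ^ 2 < ε ^ 2 := by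
    rw [h4]
    have h7 : (τ (κ (v m) (v m)) : H →L[ℂ] H) ≤ τ (κ w (v m)) := hnormal.monotone (hsq m)
    exact (re_inner_le_of_le h7 h).trans_lt hm
  rw [h3, zero_add]
  exact (hPnorm _).trans (lt_of_pow_lt_pow_left₀ 2 hε.le h6).le

variable {W : List A → H →L[ℂ] K}

theorem adjoint_comp_mem_of_wordKernel
    (hk : ∀ s t, (W s).adjoint ∘L W t = (wordKernel τ s t : A)) (s t : List A) :
    (W s).adjoint ∘L W t ∈ A := by
  rw [hk]
  exact (wordKernel τ s t).2

/-- In a space generated by words, the operators `θ(w) : H → K` exist for all intertwiners `w`, and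
`θ(w)⋆θ(w') = τ(w⋆w')`. They live a priori in the space `L` obtained from the kernel `τ(w⋆w')` on
the intertwiners, in which `K` embeds by an isometry `U`; this is onto because every `w` is a limit
of operators `(1 - r)w` that are combinations of words, with `w⋆rw` decreasing to `0`, and `τ` is
normal. -/
theorem exists_induced_family (hunital : τ 1 = 1) (hnormal : ScottContinuous τ)
    (hW : IsTotalFamily W) (hk : ∀ s t, (W s).adjoint ∘L W t = (wordKernel τ s t : A)) :
    ∃ Θ : intertwiners A W → H →L[ℂ] K,
      (∀ (w w' : intertwiners A W) (h : (w : H →L[ℂ] K).adjoint ∘L (w' : H →L[ℂ] K) ∈ A),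
        (Θ w).adjoint ∘L Θ w' = (τ ⟨_, h⟩ : A)) ∧
      ∀ s, Θ ⟨W s.tail ∘L (s.headD 1 : A),
        comp_mem_intertwiners (family_mem_intertwiners _) (s.headD 1).2⟩ = W s := by
  have hk' := adjoint_comp_mem_of_wordKernel hk
  set κ : intertwiners A W → intertwiners A W → A := fun w w' =>
    ⟨(w : H →L[ℂ] K).adjoint ∘L (w' : H →L[ℂ] K), adjoint_comp_mem hW hk' w.2 w'.2⟩ with hκ
  have hpos : IsPosKernel fun w w' => τ (κ w w') :=
    (IsPosKernel.of_gram (fun w : intertwiners A W => (w : H →L[ℂ] K)) κ fun _ _ => rfl).map τ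
  obtain ⟨L, _, _, _, V, hV, hVk⟩ := hpos.exists_decomposition
  have hVadd : ∀ w w', V (w + w') = V w + V w' := by
    intro w w'
    refine hV.ext_left fun x => ?_
    have h1 : κ x (w + w') = κ x w + κ x w' := Subtype.ext (comp_add _ _ _)
    rw [comp_add, hVk, hVk, hVk, h1, map_add]
    rfl
  have hVzero : V 0 = 0 := by
    have h1 := hVadd 0 0
    rwa [add_zero, left_eq_add] at h1
  set hd : List A → intertwiners A W := fun s => ⟨W s.tail ∘L (s.headD 1 : A),
    comp_mem_intertwiners (family_mem_intertwiners _) (s.headD 1).2⟩ with hhd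
  have hκhd : ∀ s t, τ (κ (hd s) (hd t)) = wordKernel τ s t := by
    intro s t
    rw [wordKernel_eq hunital]
    congr 1
    refine Subtype.ext ?_
    change (W s.tail ∘L ((s.headD 1 : A) : H →L[ℂ] H)).adjoint ∘L
      (W t.tail ∘L ((t.headD 1 : A) : H →L[ℂ] H)) = ((s.headD 1 : A) : H →L[ℂ] H).adjoint ∘L
        ((wordKernel τ s.tail t.tail : A) : H →L[ℂ] H) ∘L ((t.headD 1 : A) : H →L[ℂ] H)
    rw [← hk, adjoint_comp]
    rfl
  -- `K` embeds in `L`: the kernels of `W` and of `V` on the operators `W(s)x` agree, by the recursion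
  -- for the word kernel.
  obtain ⟨U, hU⟩ : ∃ U : K →L[ℂ] L, ∀ s, U ∘L W s = V (hd s) := by
    refine hW.exists_extension (fun s => V (hd s)) (fun _ => (0 : H →L[ℂ] K)) 1 zero_le_one
      fun s t => ?_
    rw [hVk, hκhd, hk, comp_zero, add_zero]
    simp
  have hUU : U.adjoint ∘L U = ContinuousLinearMap.id ℂ K := by
    refine hW.ext fun t => hW.ext_left fun s => ?_
    calc (W s).adjoint ∘L (U.adjoint ∘L U) ∘L W t = (U ∘L W s).adjoint ∘L (U ∘L W t) := by
          rw [adjoint_comp]; rfl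
      _ = _ := by
          rw [hU, hU, hVk, hκhd, ← hk]
          rfl
  -- `P` is the projection onto the orthogonal complement of the range of `U`; it is to vanish.
  set P : L →L[ℂ] L := ContinuousLinearMap.id ℂ L - U ∘L U.adjoint with hP
  have hPU : P ∘L U = 0 := by
    rw [hP, sub_comp, comp_assoc, hUU, id_comp, comp_id, sub_self]
  have hPnorm : ∀ x, ‖P x‖ ≤ ‖x‖ := by
    intro x
    have h1 : ⟪P x, U (U.adjoint x)⟫_ℂ = 0 := by
      rw [← adjoint_inner_left]
      have h2 : U.adjoint (P x) = 0 := by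
        have h3 := congrArg (fun T : K →L[ℂ] K => T (U.adjoint x)) hUU
        change U.adjoint (x - U (U.adjoint x)) = 0
        rw [map_sub, sub_eq_zero]
        exact h3.symm
      rw [h2, inner_zero_left]
    have h2 : x = P x + U (U.adjoint x) := by
      change x = (x - U (U.adjoint x)) + U (U.adjoint x)
      abel
    have h3 := norm_add_sq_eq_norm_sq_add_norm_sq_of_inner_eq_zero (P x) _ h1
    rw [← h2] at h3
    refine le_of_sq_le_sq ?_ (norm_nonneg x)
    rw [sq, sq, h3]
    exact le_add_of_nonneg_right (by positivity)
  have hframe : ∀ m : Multiset (List A), frameOp W m ∈ inducedAlgebra A W :=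
    frameOp_mem hW hk'
  have hPframe : ∀ (m : Multiset (List A)) (w : intertwiners A W),
      P ∘L V ⟨frameOp W m ∘L w, comp_mem_intertwiners' hW hk' (hframe m) w.2⟩ = 0 := by
    intro m w
    induction m using Multiset.induction with
    | empty =>
      have h1 : (⟨frameOp W 0 ∘L (w : H →L[ℂ] K), comp_mem_intertwiners' hW hk' (hframe 0) w.2⟩ :
        intertwiners A W) = 0 := Subtype.ext (zero_comp _)
      rw [h1, hVzero, comp_zero]
    -- `W(s)W(s)⋆w = W(s)a` with `a = W(s)⋆w ∈ A`, and `V(W(s)a)` is in the range of `U`.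
    | cons s m ih =>
      set a : A := ⟨(W s).adjoint ∘L (w : H →L[ℂ] K),
        adjoint_comp_mem hW hk' (family_mem_intertwiners s) w.2⟩
      have h1 : (⟨frameOp W (s ::ₘ m) ∘L (w : H →L[ℂ] K),
          comp_mem_intertwiners' hW hk' (hframe (s ::ₘ m)) w.2⟩ : intertwiners A W)
          = hd (a :: s) + ⟨frameOp W m ∘L (w : H →L[ℂ] K),
            comp_mem_intertwiners' hW hk' (hframe m) w.2⟩ := by
        refine Subtype.ext ?_
        change frameOp W (s ::ₘ m) ∘L (w : H →L[ℂ] K) = _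
        rw [frameOp_cons, add_comp]
        rfl
      rw [h1, hVadd, comp_add, ih, add_zero, ← hU, ← comp_assoc, hPU, zero_comp]
  have hPV : ∀ w, P ∘L V w = 0 := fun w =>
    comp_eq_zero_of_comp_frameOp_eq_zero hnormal hW hk' V hVadd (fun w w' _ => hVk w w') hPnorm
      (fun m w _ => hPframe m w) w
  refine ⟨fun w => U.adjoint ∘L V w, fun w w' h => ?_, fun s => ?_⟩
  · have h1 : U ∘L U.adjoint ∘L V w' = V w' := by
      have h2 := hPV w'
      rw [hP, sub_comp, id_comp, sub_eq_zero] at h2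
      exact h2.symm
    calc (U.adjoint ∘L V w).adjoint ∘L (U.adjoint ∘L V w')
        = (V w).adjoint ∘L (U ∘L U.adjoint ∘L V w') := by
          rw [adjoint_comp, adjoint_adjoint]; rfl
      _ = _ := by rw [h1, hVk]
  · change U.adjoint ∘L V (hd s) = W s
    rw [← hU, ← comp_assoc, hUU, id_comp]

end InducedFamily

/-! ### The endomorphism of the dilation -/

section Endomorphism

open ContinuousLinearMap
open scoped InnerProductSpace

variable {H : Type u} [NormedAddCommGroup H] [InnerProductSpace ℂ H] [CompleteSpace H]
  {A : VonNeumannAlgebra H} {τ : A →CP A} {K : Type u} [NormedAddCommGroup K]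
  [InnerProductSpace ℂ K] [CompleteSpace K] {S : Type*} {W : S → H →L[ℂ] K}

/-- A family of operators `Θ(w) : H → K`, indexed by the intertwiners `w`, that satisfies
`Θ(w)⋆Θ(w') = τ(w⋆w')`. -/
def IsGramImage (τ : A →CP A) (Θ : intertwiners A W → H →L[ℂ] K) : Prop :=
  ∀ (w w' : intertwiners A W) (h : (w : H →L[ℂ] K).adjoint ∘L (w' : H →L[ℂ] K) ∈ A),
    (Θ w).adjoint ∘L Θ w' = (τ ⟨_, h⟩ : A)

theorem IsTotalFamily.of_forall_exists {S' : Type*} {V : S' → H →L[ℂ] K} (hW : IsTotalFamily W)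
    (h : ∀ s, ∃ t, V t = W s) : IsTotalFamily V := by
  refine top_le_iff.1 (hW.ge.trans (Submodule.topologicalClosure_mono (Submodule.span_mono ?_)))
  rintro _ ⟨s, x, rfl⟩
  obtain ⟨t, ht⟩ := h s
  exact ⟨t, x, by rw [ht]⟩

variable {Θ : intertwiners A W → H →L[ℂ] K}

theorem IsGramImage.mem_intertwiners (hΘ : IsGramImage τ Θ) (hW : IsTotalFamily W)
    (hk : ∀ s t, (W s).adjoint ∘L W t ∈ A) (hs : ∀ s, ∃ w, Θ w = W s) (w : intertwiners A W) :
    Θ w ∈ intertwiners A W := by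
  refine fun c hc T hT => hW.ext_left fun t => ?_
  obtain ⟨w', hw'⟩ := hs t
  have hmem : (W t).adjoint ∘L Θ w ∈ A := by
    rw [← hw', hΘ w' w (adjoint_comp_mem hW hk w'.2 w.2)]
    exact (τ _).2
  have h1 := congrArg ContinuousLinearMap.adjoint (hT.adjoint hW hk hc t)
  rw [adjoint_comp, adjoint_comp, adjoint_adjoint, adjoint_adjoint] at h1
  calc (W t).adjoint ∘L T ∘L Θ w = ((W t).adjoint ∘L T) ∘L Θ w := rfl
    _ = c ∘L ((W t).adjoint ∘L Θ w) := by rw [h1]; rfl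
    _ = ((W t).adjoint ∘L Θ w) ∘L c := (comp_comm_of_mem hmem hc).symm
    _ = _ := rfl

theorem IsGramImage.map_add (hΘ : IsGramImage τ Θ) (hW : IsTotalFamily W)
    (hk : ∀ s t, (W s).adjoint ∘L W t ∈ A) (hV : IsTotalFamily Θ) (w w' : intertwiners A W) :
    Θ (w + w') = Θ w + Θ w' := by
  refine hV.ext_left fun x => ?_
  have hm : ∀ y : intertwiners A W, (x : H →L[ℂ] K).adjoint ∘L (y : H →L[ℂ] K) ∈ A := fun y =>
    adjoint_comp_mem hW hk x.2 y.2
  have h1 : (⟨_, hm (w + w')⟩ : A) = ⟨_, hm w⟩ + ⟨_, hm w'⟩ := Subtype.ext (comp_add _ _ _)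
  rw [comp_add, hΘ _ _ (hm _), hΘ _ _ (hm _), hΘ _ _ (hm _), h1, _root_.map_add]
  rfl

theorem IsGramImage.map_smul (hΘ : IsGramImage τ Θ) (hW : IsTotalFamily W)
    (hk : ∀ s t, (W s).adjoint ∘L W t ∈ A) (hV : IsTotalFamily Θ) (r : ℂ)
    (w : intertwiners A W) : Θ (r • w) = r • Θ w := by
  refine hV.ext_left fun x => ?_
  have hm : ∀ y : intertwiners A W, (x : H →L[ℂ] K).adjoint ∘L (y : H →L[ℂ] K) ∈ A := fun y =>
    adjoint_comp_mem hW hk x.2 y.2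
  have h1 : (⟨_, hm (r • w)⟩ : A) = r • ⟨_, hm w⟩ := Subtype.ext (comp_smul _ _ _)
  rw [comp_smul, hΘ _ _ (hm _), hΘ _ _ (hm _), h1, _root_.map_smul]
  rfl

/-- Boundedness of `Θ(w)h ↦ Θ(bw)h`, by positivity of the kernel `τ(w⋆(‖b‖² - b⋆b)w')`. -/
theorem IsGramImage.exists_comp_eq (hΘ : IsGramImage τ Θ) (hW : IsTotalFamily W)
    (hk : ∀ s t, (W s).adjoint ∘L W t ∈ A) (hV : IsTotalFamily Θ) {b : K →L[ℂ] K}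
    (hb : b ∈ inducedAlgebra A W) :
    ∃ T : K →L[ℂ] K, ∀ w : intertwiners A W,
      T ∘L Θ w = Θ ⟨b ∘L w, comp_mem_intertwiners' hW hk hb w.2⟩ := by
  obtain ⟨d, hd⟩ := CStarAlgebra.exists_star_mul_self_add_star_mul_self
    (⟨b, hb⟩ : inducedAlgebra A W)
  have hd' : b.adjoint ∘L b + (d : K →L[ℂ] K).adjoint ∘L (d : K →L[ℂ] K)
      = ((‖b‖ ^ 2 : ℝ) : ℂ) • ContinuousLinearMap.id ℂ K := congrArg Subtype.val hd
  refine hV.exists_extension _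
    (fun w => Θ ⟨(d : K →L[ℂ] K) ∘L w, comp_mem_intertwiners' hW hk d.2 w.2⟩) ‖b‖ (norm_nonneg _)
    fun w w' => ?_
  have hm : ∀ y z : intertwiners A W, (y : H →L[ℂ] K).adjoint ∘L (z : H →L[ℂ] K) ∈ A :=
    fun y z => adjoint_comp_mem hW hk y.2 z.2
  rw [hΘ _ _ (hm _ _), hΘ _ _ (hm _ _), hΘ _ _ (hm _ _)]
  refine congrArg (Subtype.val (p := (· ∈ A))) (a₁ := τ _ + τ _)
    (a₂ := ((‖b‖ ^ 2 : ℝ) : ℂ) • τ _) ?_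
  rw [← _root_.map_add, ← _root_.map_smul]
  refine congrArg τ (Subtype.ext ?_)
  change (b ∘L (w : H →L[ℂ] K)).adjoint ∘L b ∘L (w' : H →L[ℂ] K)
    + ((d : K →L[ℂ] K) ∘L (w : H →L[ℂ] K)).adjoint ∘L (d : K →L[ℂ] K) ∘L (w' : H →L[ℂ] K)
    = ((‖b‖ ^ 2 : ℝ) : ℂ) • ((w : H →L[ℂ] K).adjoint ∘L (w' : H →L[ℂ] K))
  rw [adjoint_comp, adjoint_comp]
  calc _ = (w : H →L[ℂ] K).adjoint ∘L
        (b.adjoint ∘L b + (d : K →L[ℂ] K).adjoint ∘L (d : K →L[ℂ] K)) ∘L (w' : H →L[ℂ] K) := by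
        rw [add_comp, comp_add]; rfl
    _ = _ := by rw [hd', smul_comp, comp_smul, id_comp]

/-- The endomorphism `θ` is defined by `θ(b)Θ(w) = Θ(bw)`. -/
theorem IsGramImage.exists_endomorphism (hΘ : IsGramImage τ Θ) (hW : IsTotalFamily W)
    (hk : ∀ s t, (W s).adjoint ∘L W t ∈ A) (hs : ∀ s, ∃ w, Θ w = W s) :
    ∃ θ : inducedAlgebra A W →⋆ₐ[ℂ] inducedAlgebra A W,
      ∀ (b : inducedAlgebra A W) (w : intertwiners A W)
        (h : (b : K →L[ℂ] K) ∘L (w : H →L[ℂ] K) ∈ intertwiners A W),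
        (θ b : K →L[ℂ] K) ∘L Θ w = Θ ⟨_, h⟩ := by
  have hV : IsTotalFamily Θ := hW.of_forall_exists hs
  have hm : ∀ (b : inducedAlgebra A W) (w : intertwiners A W),
      (b : K →L[ℂ] K) ∘L (w : H →L[ℂ] K) ∈ intertwiners A W := fun b w =>
    comp_mem_intertwiners' hW hk b.2 w.2
  obtain ⟨f, hf⟩ : ∃ f : inducedAlgebra A W → K →L[ℂ] K, ∀ b w, f b ∘L Θ w = Θ ⟨_, hm b w⟩ :=
    ⟨fun b => (hΘ.exists_comp_eq hW hk hV b.2).choose,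
      fun b => (hΘ.exists_comp_eq hW hk hV b.2).choose_spec⟩
  have hfB : ∀ b, f b ∈ inducedAlgebra A W := fun b => by
    refine (mem_inducedAlgebra_iff hW hk).2 fun c hc T hT => hV.ext fun w => ?_
    have h1 := hΘ.mem_intertwiners hW hk hs w c hc T hT
    have h2 := hΘ.mem_intertwiners hW hk hs ⟨_, hm b w⟩ c hc T hT
    rw [comp_assoc, comp_assoc, hf, h1, h2, ← comp_assoc, hf]
  have hone : f 1 = 1 := hV.ext fun w => by
    rw [hf]
    exact congrArg Θ (Subtype.ext (id_comp _))
  have hmul : ∀ b b', f (b * b') = f b * f b' := fun b b' => hV.ext fun w => by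
    change _ = (f b ∘L f b') ∘L Θ w
    rw [comp_assoc, hf, hf, hf]
    rfl
  have hadd : ∀ b b', f (b + b') = f b + f b' := fun b b' => hV.ext fun w => by
    rw [add_comp, hf, hf, hf, ← hΘ.map_add hW hk hV]
    exact congrArg Θ (Subtype.ext (add_comp _ _ _))
  have hsmul : ∀ (r : ℂ) b, f (r • b) = r • f b := fun r b => hV.ext fun w => by
    rw [smul_comp, hf, hf, ← hΘ.map_smul hW hk hV]
    exact congrArg Θ (Subtype.ext (smul_comp _ _ _))
  have hstar : ∀ b, f (star b) = star (f b) := fun b => by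
    refine hV.ext fun w' => hV.ext_left fun w => ?_
    have h1 : (Θ w).adjoint ∘L star (f b) = (f b ∘L Θ w).adjoint := by
      rw [adjoint_comp]; rfl
    have hn : ∀ y z : intertwiners A W, (y : H →L[ℂ] K).adjoint ∘L (z : H →L[ℂ] K) ∈ A :=
      fun y z => adjoint_comp_mem hW hk y.2 z.2
    rw [← comp_assoc (Θ w).adjoint (star (f b)), h1, hf, hf, hΘ _ _ (hn _ _), hΘ _ _ (hn _ _)]
    refine congrArg Subtype.val (congrArg τ (Subtype.ext ?_))
    change (w : H →L[ℂ] K).adjoint ∘L (b : K →L[ℂ] K).adjoint ∘L (w' : H →L[ℂ] K)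
      = ((b : K →L[ℂ] K) ∘L (w : H →L[ℂ] K)).adjoint ∘L (w' : H →L[ℂ] K)
    rw [adjoint_comp]
    rfl
  refine ⟨{ toFun := fun b => ⟨f b, hfB b⟩
            map_one' := Subtype.ext hone
            map_mul' := fun b b' => Subtype.ext (hmul b b')
            map_zero' := Subtype.ext ?_
            map_add' := fun b b' => Subtype.ext (hadd b b')
            commutes' := fun r => Subtype.ext ?_
            map_star' := fun b => Subtype.ext (hstar b) }, fun b w _ => hf b w⟩
  · have h1 := hsmul 0 0
    rw [zero_smul, zero_smul] at h1
    exact h1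
  · rw [Algebra.algebraMap_eq_smul_one]
    change f (r • 1) = r • (1 : K →L[ℂ] K)
    rw [hsmul, hone]

/-- If `Θ(w) = v`, then `v⋆θ(b)v = τ(w⋆bw)`; with the inclusion of `H` for `v = w`, this is the
dilation property. -/
theorem IsGramImage.adjoint_comp_comp (hΘ : IsGramImage τ Θ)
    {θ : inducedAlgebra A W → inducedAlgebra A W}
    (hθ : ∀ (b : inducedAlgebra A W) (w : intertwiners A W)
      (h : (b : K →L[ℂ] K) ∘L (w : H →L[ℂ] K) ∈ intertwiners A W),
      (θ b : K →L[ℂ] K) ∘L Θ w = Θ ⟨_, h⟩)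
    {w : intertwiners A W} {v : H →L[ℂ] K} (hv : Θ w = v) (b : inducedAlgebra A W)
    (h : (b : K →L[ℂ] K) ∘L (w : H →L[ℂ] K) ∈ intertwiners A W)
    (h' : (w : H →L[ℂ] K).adjoint ∘L (b : K →L[ℂ] K) ∘L (w : H →L[ℂ] K) ∈ A) :
    v.adjoint ∘L (θ b : K →L[ℂ] K) ∘L v = (τ ⟨_, h'⟩ : A) := by
  rw [← hv, hθ b w h]
  exact hΘ w ⟨_, h⟩ h'

/-- Normality of `τ` passes to `θ`, since `Θ(w)⋆θ(b)Θ(w) = τ(w⋆bw)`. -/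
theorem IsGramImage.scottContinuous (hnormal : ScottContinuous τ) (hΘ : IsGramImage τ Θ)
    (hW : IsTotalFamily W) (hk : ∀ s t, (W s).adjoint ∘L W t ∈ A) (hV : IsTotalFamily Θ)
    (θ : inducedAlgebra A W →⋆ₐ[ℂ] inducedAlgebra A W)
    (hθ : ∀ (b : inducedAlgebra A W) (w : intertwiners A W)
      (h : (b : K →L[ℂ] K) ∘L (w : H →L[ℂ] K) ∈ intertwiners A W),
      (θ b : K →L[ℂ] K) ∘L Θ w = Θ ⟨_, h⟩) : ScottContinuous θ := by
  intro d hne hd b hb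
  have hmono : Monotone θ := OrderHomClass.mono θ
  refine VonNeumannAlgebra.isLUB_of_forall_exists_re_inner_lt (hne.image θ)
    (hd.mono_comp fun _ _ h => hmono h) ?_ hV ?_
  · rintro _ ⟨x, hx, rfl⟩
    exact hmono (hb.1 hx)
  · rintro _ ⟨w, v, rfl⟩ ε hε
    have hmem : ∀ x : inducedAlgebra A W,
        (w : H →L[ℂ] K).adjoint ∘L (x : K →L[ℂ] K) ∘L (w : H →L[ℂ] K) ∈ A := fun x =>
      adjoint_comp_mem hW hk w.2 (comp_mem_intertwiners' hW hk x.2 w.2)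
    obtain ⟨g, hg⟩ : ∃ g : inducedAlgebra A W → A, ∀ x, (g x : H →L[ℂ] H)
        = (w : H →L[ℂ] K).adjoint ∘L (x : K →L[ℂ] K) ∘L (w : H →L[ℂ] K) :=
      ⟨fun x => ⟨_, hmem x⟩, fun _ => rfl⟩
    have hgmono : Monotone g := fun x y hxy => by
      change (g x : H →L[ℂ] H) ≤ g y
      rw [hg, hg]
      exact adjoint_conj_mono hxy _
    have hgsub : ∀ x, ((g b - g x : A) : H →L[ℂ] H) = (w : H →L[ℂ] K).adjoint ∘L
        ((b - x : inducedAlgebra A W) : K →L[ℂ] K) ∘L (w : H →L[ℂ] K) := fun x => by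
      change (g b : H →L[ℂ] H) - g x = (w : H →L[ℂ] K).adjoint ∘L
        ((b : K →L[ℂ] K) - (x : K →L[ℂ] K)) ∘L (w : H →L[ℂ] K)
      rw [hg, hg, sub_comp, comp_sub]
    have hτg : ∀ x, (Θ w).adjoint ∘L (θ x : K →L[ℂ] K) ∘L Θ w = (τ (g x) : A) := fun x => by
      have h1 : g x = ⟨_, hmem x⟩ := Subtype.ext (hg x)
      rw [h1]
      exact hΘ.adjoint_comp_comp hθ rfl x (comp_mem_intertwiners' hW hk x.2 w.2) (hmem x)
    have : Nonempty d := hne.to_subtype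
    have : IsDirectedOrder d := directedOn_iff_isDirectedOrder.1 hd
    obtain ⟨⟨x, hx⟩, hlt⟩ := VonNeumannAlgebra.exists_re_inner_map_lt hnormal
      (f := fun x : d => g x) (fun x y h => hgmono h) (a := g b) (fun x => hgmono (hb.1 x.2))
      (fun v' δ hδ => by
        obtain ⟨x, hx, h1⟩ := VonNeumannAlgebra.exists_re_inner_lt_of_isLUB hne hd hb
          ((w : H →L[ℂ] K) v') hδ
        refine ⟨⟨x, hx⟩, ?_⟩
        rw [hgsub, comp_apply, adjoint_inner_right]
        exact h1) v hε
    refine ⟨θ x, ⟨x, hx, rfl⟩, ?_⟩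
    have h1 : ((τ (g b) - τ (g x) : A) : H →L[ℂ] H) = (Θ w).adjoint ∘L
        ((θ b - θ x : inducedAlgebra A W) : K →L[ℂ] K) ∘L Θ w := by
      change (τ (g b) : H →L[ℂ] H) - τ (g x) = (Θ w).adjoint ∘L
        ((θ b : K →L[ℂ] K) - (θ x : K →L[ℂ] K)) ∘L Θ w
      rw [← hτg, ← hτg, sub_comp, comp_sub]
    rw [h1, comp_apply, adjoint_inner_right] at hlt
    exact hlt

end Endomorphism

/-! ### The minimal dilation -/

namespace VNDilation

open ContinuousLinearMap

variable {H : Type u} [NormedAddCommGroup H] [InnerProductSpace ℂ H] [CompleteSpace H]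
  {A : VonNeumannAlgebra H} {τ : A →CP A} (D : VNDilation τ)

theorem embed_comp_incl (a : A) :
    (D.embed a : D.K →L[ℂ] D.K) ∘L D.incl = D.incl ∘L (a : H →L[ℂ] H) := by
  ext h
  change (D.embed a : D.K →L[ℂ] D.K) (D.incl h) = D.incl ((a : H →L[ℂ] H) h)
  rw [embed_apply, adjoint_incl_incl]

/-- An operator that commutes with all `θⁿ(x)` acts on words as its compression to `H`. -/
theorem apply_word {c : D.K →L[ℂ] D.K}
    (hc : ∀ (n : ℕ) (x : A), c * ((D.θ^[n] (D.embed x) : D.B) : D.K →L[ℂ] D.K)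
      = ((D.θ^[n] (D.embed x) : D.B) : D.K →L[ℂ] D.K) * c) (l : List A) (h : H) :
    c (D.word l h) = D.word l (D.incl.adjoint (c (D.incl h))) := by
  induction l with
  | nil =>
    have h1 := congrArg (fun T : D.K →L[ℂ] D.K => T (D.incl h)) (hc 0 1)
    change c ((D.embed 1 : D.K →L[ℂ] D.K) (D.incl h))
      = (D.embed 1 : D.K →L[ℂ] D.K) (c (D.incl h)) at h1
    rw [embed_apply, embed_apply, adjoint_incl_incl] at h1
    exact h1
  | cons x l ih =>
    have h1 := congrArg (fun T : D.K →L[ℂ] D.K => T (D.word l h)) (hc (l.length + 1) x)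
    change c (((D.θ^[l.length + 1] (D.embed x) : D.B) : D.K →L[ℂ] D.K) (D.word l h))
      = ((D.θ^[l.length + 1] (D.embed x) : D.B) : D.K →L[ℂ] D.K) (c (D.word l h)) at h1
    rw [ih] at h1
    exact h1

variable {D} {W : List A → H →L[ℂ] D.K}

/-- A word is the value of an intertwiner `w`, and inserting a letter `x` on its innermost side applies
`Θ` to `w x`. -/
theorem exists_word_append_eq {Θ : intertwiners A W → H →L[ℂ] D.K} (hW : IsTotalFamily W)
    (hk : ∀ s t, (W s).adjoint ∘L W t ∈ A) (hB : ∀ b ∈ D.B, b ∈ inducedAlgebra A W)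
    (hnil : W [] = D.incl) (hΘnil : Θ ⟨W [], family_mem_intertwiners []⟩ = W [])
    (hθ : ∀ (b : D.B) (w : intertwiners A W)
      (h : (b : D.K →L[ℂ] D.K) ∘L (w : H →L[ℂ] D.K) ∈ intertwiners A W),
      (D.θ b : D.K →L[ℂ] D.K) ∘L Θ w = Θ ⟨_, h⟩) (l : List A) :
    ∃ w : intertwiners A W, (∀ h, (w : H →L[ℂ] D.K) h = D.word l h) ∧
      ∀ (x : A) h, D.word (l ++ [x]) h = Θ ⟨_, comp_mem_intertwiners w.2 x.2⟩ h := by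
  have hm : ∀ (b : D.B) (w : intertwiners A W),
      (b : D.K →L[ℂ] D.K) ∘L (w : H →L[ℂ] D.K) ∈ intertwiners A W := fun b w =>
    comp_mem_intertwiners' hW hk (hB b b.2) w.2
  induction l with
  | nil =>
    refine ⟨⟨W [], family_mem_intertwiners []⟩, fun h => ?_, fun x h => ?_⟩
    · change W [] h = D.incl h
      rw [hnil]
    · have h1 := hθ (D.embed x) ⟨W [], family_mem_intertwiners []⟩ (hm _ _)
      rw [hΘnil] at h1
      change (D.θ (D.embed x) : D.K →L[ℂ] D.K) (D.incl h) = _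
      have h2 : (⟨_, hm (D.embed x) ⟨W [], family_mem_intertwiners []⟩⟩ : intertwiners A W)
          = ⟨_, comp_mem_intertwiners (family_mem_intertwiners []) x.2⟩ := Subtype.ext (by
        change (D.embed x : D.K →L[ℂ] D.K) ∘L W [] = W [] ∘L (x : H →L[ℂ] H)
        rw [hnil, embed_comp_incl])
      rw [h2] at h1
      have h3 := congrArg (fun T : H →L[ℂ] D.K => T h) h1
      have h4 : D.incl h = W [] h := by rw [hnil]
      rw [h4]
      exact h3
  | cons y l ih =>
    obtain ⟨w, hw, hwx⟩ := ih
    refine ⟨⟨_, hm (D.θ^[l.length + 1] (D.embed y)) w⟩, fun h => ?_, fun x h => ?_⟩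
    · change ((D.θ^[l.length + 1] (D.embed y) : D.B) : D.K →L[ℂ] D.K) ((w : H →L[ℂ] D.K) h) = _
      rw [hw]
      rfl
    · change ((D.θ^[(l ++ [x]).length + 1] (D.embed y) : D.B) : D.K →L[ℂ] D.K)
        (D.word (l ++ [x]) h) = _
      rw [hwx, List.length_append, List.length_singleton, Function.iterate_succ_apply']
      exact congrArg (fun T : H →L[ℂ] D.K => T h) (hθ (D.θ^[l.length + 1] (D.embed y))
        ⟨_, comp_mem_intertwiners w.2 x.2⟩ (hm _ _))

/-- Both descriptions of the words agree; the innermost letter of `D.word l` is the last one of `l`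
and the first one of the list at which `W` is taken. -/
theorem word_eq {Θ : intertwiners A W → H →L[ℂ] D.K} (hW : IsTotalFamily W)
    (hk : ∀ s t, (W s).adjoint ∘L W t ∈ A) (hB : ∀ b ∈ D.B, b ∈ inducedAlgebra A W)
    (hnil : W [] = D.incl)
    (hΘ : ∀ s, Θ ⟨W s.tail ∘L (s.headD 1 : A),
        comp_mem_intertwiners (family_mem_intertwiners _) (s.headD 1).2⟩ = W s)
    (hθ : ∀ (b : D.B) (w : intertwiners A W)
      (h : (b : D.K →L[ℂ] D.K) ∘L (w : H →L[ℂ] D.K) ∈ intertwiners A W),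
      (D.θ b : D.K →L[ℂ] D.K) ∘L Θ w = Θ ⟨_, h⟩) (l : List A) (h : H) :
    D.word l h = W l.reverse h := by
  induction l using List.reverseRecOn generalizing h with
  | nil => exact (congrArg (fun T : H →L[ℂ] D.K => T h) hnil).symm
  | append_singleton l x ih =>
    obtain ⟨w, hw, hwx⟩ := exists_word_append_eq hW hk hB hnil (hΘ []) hθ l
    have h1 : (w : H →L[ℂ] D.K) = W l.reverse := ContinuousLinearMap.ext fun v => by
      rw [hw, ih]
    have h2 : (⟨_, comp_mem_intertwiners w.2 x.2⟩ : intertwiners A W)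
        = ⟨_, comp_mem_intertwiners (family_mem_intertwiners l.reverse) x.2⟩ := by
      refine Subtype.ext ?_
      change (w : H →L[ℂ] D.K) ∘L (x : H →L[ℂ] H) = _
      rw [h1]
    rw [hwx, h2, List.reverse_append]
    exact congrArg (fun T : H →L[ℂ] D.K => T h) (hΘ (x :: l.reverse))

/-- A dilation spanned by words, whose algebra is the induced algebra, is minimal. An operator that
commutes with all `θⁿ(x)` is induced by its compression to `H`, so that the algebra generated by the
`θⁿ(x)` contains the induced algebra. -/
theorem isMinimal_of_word_eq (hW : IsTotalFamily W) (hk : ∀ s t, (W s).adjoint ∘L W t ∈ A)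
    (hB : ∀ b ∈ D.B, b ∈ inducedAlgebra A W) (hword : ∀ l h, D.word l h = W l.reverse h) :
    D.IsMinimal where
  space := by
    refine top_le_iff.1 (hW.ge.trans
      (Submodule.topologicalClosure_mono (Submodule.span_mono ?_)))
    rintro _ ⟨s, h, rfl⟩
    exact ⟨s.reverse, h, by rw [hword, List.reverse_reverse]⟩
  algebra C hC b hb := by
    refine VonNeumannAlgebra.mem_of_forall_commutant fun c hc => ?_
    have hcomm : ∀ (n : ℕ) (x : A), c * ((D.θ^[n] (D.embed x) : D.B) : D.K →L[ℂ] D.K)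
        = ((D.θ^[n] (D.embed x) : D.B) : D.K →L[ℂ] D.K) * c := fun n x =>
      (VonNeumannAlgebra.mem_commutant_iff.1 hc _ (hC n x)).symm
    refine (mem_inducedAlgebra_iff hW hk).1 (hB b hb) (D.incl.adjoint ∘L c ∘L D.incl) ?_ c
      fun s => ?_
    · refine VonNeumannAlgebra.mem_commutant_iff.2 fun a ha => ?_
      ext h
      have h1 := congrArg (fun T : D.K →L[ℂ] D.K => D.incl.adjoint (T (D.incl h)))
        (hcomm 0 ⟨a, ha⟩)
      change D.incl.adjoint (c (D.incl (a (D.incl.adjoint (D.incl h)))))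
        = D.incl.adjoint (D.incl (a (D.incl.adjoint (c (D.incl h))))) at h1
      rw [adjoint_incl_incl, adjoint_incl_incl] at h1
      exact h1.symm
    · ext h
      have h1 := D.apply_word hcomm s.reverse h
      rw [hword, hword, List.reverse_reverse] at h1
      exact h1

end VNDilation

section Existence

open ContinuousLinearMap

variable {H : Type u} [NormedAddCommGroup H] [InnerProductSpace ℂ H] [CompleteSpace H]
  {A : VonNeumannAlgebra H} {τ : A →CP A}

/-- Every normal unital completely positive map has a minimal dilation. Its space is given by the
word kernel, its algebra is induced by `A`, and `θ(b)` maps `Θ(w)h` to `Θ(bw)h`. -/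
theorem exists_isMinimal (hunital : τ 1 = 1) (hnormal : ScottContinuous τ) :
    ∃ D : VNDilation τ, D.IsMinimal := by
  obtain ⟨K, _, _, _, W, hW, hWk⟩ := (isPosKernel_wordKernel hunital).exists_decomposition
  have hk := adjoint_comp_mem_of_wordKernel hWk
  obtain ⟨Θ, hΘ, hhd⟩ := exists_induced_family hunital hnormal hW hWk
  have hs : ∀ s, ∃ w, Θ w = W s := fun s => ⟨_, hhd s⟩
  obtain ⟨θ, hθ⟩ := IsGramImage.exists_endomorphism hΘ hW hk hs
  have hnil : (W []).adjoint ∘L W [] = ContinuousLinearMap.id ℂ H := by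
    rw [hWk, wordKernel]
    rfl
  -- The empty word embeds `H` isometrically.
  obtain ⟨ι, hι⟩ : ∃ ι : H →ₗᵢ[ℂ] K, ι.toContinuousLinearMap = W [] :=
    ⟨⟨W [], (ContinuousLinearMap.norm_map_iff_adjoint_comp_self (W [])).2 hnil⟩, rfl⟩
  have hmem : ∀ b : inducedAlgebra A W, (W []).adjoint ∘L (b : K →L[ℂ] K) ∘L W [] ∈ A := fun b =>
    adjoint_comp_mem hW hk (family_mem_intertwiners [])
      (comp_mem_intertwiners' hW hk b.2 (family_mem_intertwiners []))
  have hcompress : ∀ b : inducedAlgebra A W,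
      (⟨_, hmem (θ b)⟩ : A) = τ ⟨_, hmem b⟩ := fun b => by
    have h1 : Θ ⟨W [], family_mem_intertwiners []⟩ = W [] := hhd []
    exact Subtype.ext (IsGramImage.adjoint_comp_comp hΘ hθ h1 b
      (comp_mem_intertwiners' hW hk b.2 (family_mem_intertwiners [])) (hmem b))
  have hiter : ∀ (n : ℕ) (b : inducedAlgebra A W),
      (⟨_, hmem (θ^[n] b)⟩ : A) = τ^[n] ⟨_, hmem b⟩ := fun n => by
    induction n with
    | zero => exact fun b => rfl
    | succ n ih =>
      intro b
      have h1 := ih (θ b)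
      rw [hcompress] at h1
      exact h1
  have hembed : ∀ a ∈ A, W [] ∘L a ∘L (W []).adjoint ∈ inducedAlgebra A W := fun a ha =>
    comp_adjoint_mem hW hk (comp_mem_intertwiners (family_mem_intertwiners []) ha)
      (family_mem_intertwiners [])
  refine ⟨{ K := K
            ι := ι
            B := inducedAlgebra A W
            embed_mem := fun a ha => by rw [hι]; exact hembed a ha
            compress_mem := fun b hb => by rw [hι]; exact hmem ⟨b, hb⟩
            θ := θ
            normal := IsGramImage.scottContinuous hnormal hΘ hW hk (hW.of_forall_exists hs) θ hθ
            dilates := fun n a => ?_ }, ?_⟩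
  · simp only [hι]
    have h1 : a = ⟨_, hmem ⟨_, hembed a a.2⟩⟩ := Subtype.ext (by
      change (a : H →L[ℂ] H)
        = ((W []).adjoint ∘L W []) ∘L (a : H →L[ℂ] H) ∘L ((W []).adjoint ∘L W [])
      rw [hnil]
      rfl)
    conv_lhs => rw [h1, ← hiter]
  · exact VNDilation.isMinimal_of_word_eq hW hk (fun _ h => h)
      (VNDilation.word_eq hW hk (fun _ h => h) hι.symm hhd hθ)

end Existence

theorem theorem2p5 {H : Type u} [NormedAddCommGroup H] [InnerProductSpace ℂ H] [CompleteSpace H]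
    (A : VonNeumannAlgebra H) (τ : A →CP A) (hunital : τ 1 = 1) (hnormal : ScottContinuous τ) :
    (∃ D : VNDilation τ, D.IsMinimal) ∧
    ∀ D : VNDilation τ, D.IsMinimal →
      Set.BijOn D.compress (peripheralSpace D.θ : Set D.B) (peripheralSpace τ : Set A) ∧
      (∀ (lam mu : ℂ), ‖lam‖ = 1 → ‖mu‖ = 1 → ∀ x y : A, τ x = lam • x → τ y = mu • y →
        ∀ h : H, Tendsto
          (fun n : ℕ => ((((lam * mu) ^ n)⁻¹ • τ^[n] (x * y) : A) : H →L[ℂ] H) h)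
          atTop (𝓝 ((D.peripheralMul x y : H →L[ℂ] H) h))) ∧
      ((∃ φ : A →ₚ[ℂ] ℂ, φ 1 = 1 ∧ (∀ a : A, 0 ≤ a → φ a = 0 → a = 0) ∧
          ∀ a : A, φ (τ a) = φ a) →
        ∀ (lam mu : ℂ), ‖lam‖ = 1 → ‖mu‖ = 1 → ∀ x y : A, τ x = lam • x → τ y = mu • y →
          D.peripheralMul x y = x * y) :=
  ⟨exists_isMinimal hunital hnormal, fun _ hD =>
    ⟨VNDilation.bijOn_compress hunital hD,
      fun _ _ hlam hmu _ _ hx hy h =>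
        VNDilation.tendsto_peripheralMul hunital hD hlam hmu hx hy h,
      fun ⟨φ, _, hφ, hinv⟩ _ _ hlam hmu _ _ hx hy =>
        VNDilation.peripheralMul_eq_mul hunital hD φ hφ hinv hlam hmu hx hy⟩⟩
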